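/- Conventions. The empty set counts as an ideal of a semigroup; for an ideal $I$ of $S$, $S/I$ is the Rees factor semigroup, and $S/\emptyset=S$. For $x,y\in S$ and $z_1,z_2,\ldots\in S^1$ put $\lambda_0=x$, $\rho_0=y$, $\lambda_{n+1}=\lambda_n z_{n+1}\rho_n$, $\rho_{n+1}=\rho_n z_{n+1}\lambda_n$. A semigroup $S$ is *nilpotent* (Mal'cev) if for some $n\ge 1$ one has $\lambda_n(a,b,c_1,\ldots,c_n)=\rho_n(a,b,c_1,\ldots,c_n)$ for all $a,b\in S$, $c_1,\ldots,c_n\in S^1$. The upper non-nilpotent graph $\mathcal N_S$ has vertex set $S$, with an edge between $x$ and $y$ if $\langle x,y\rangle$ is not nilpotent. $S$ is *pseudo-nilpotent* if, whenever $x,y\in S$, $w_1,\ldots,w_m\in S^1$, $0\le t<m$, $I$ is a (possibly empty) ideal of $T=\langle x,y,w_1,\ldots,w_m\rangle$, and, with $\lambda_k=\lambda_k(x,y,w_1,\ldots,w_k)$ and $\rho_k=\rho_k(x,y,w_1,\ldots,w_k)$, one has $\lambda_t\ne\rho_t$, $(\lambda_t,\rho_t)=(\lambda_m,\rho_m)$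 and $\lambda_m,\rho_m\notin I$, then there is an edge in $\mathcal N_{T/I}$ between $\lambda_k$ and $\rho_k$ for every $0\le k\le m$. Let $S=S_1\supset S_2\supset\cdots\supset S_m\supset S_{m+1}=\emptyset$ be a principal series of $S$: each $S_i$ is an ideal, and no ideal of $S$ lies strictly between $S_i$ and $S_{i+1}$. Write $C_i=S_i\setminus S_{i+1}$. Let $$F_i=\{s\in S\setminus S_i \mid sx\notin S_{i+1}\text{ or }xs\notin S_{i+1}\text{ for some }x\in C_i\},$$ $$i^*=\{j\le i\mid C_j\subseteq F_i\cup C_i\},\qquad S^{(i)}=\bigcup_{j\in i^*}C_j .$$ $C_i$ is a *root* if $S_i/S_{i+1}$ is not nilpotent and $\mathcal N_S$ has no edge between an element of $C_i$ and an element of $S_{i+1}$; in this case $S^{(i)}$ is called the *stem* of $C_i$. $C_i$ is an *isolated subset* if it is not a root and, for every $j$ with $C_i\subseteq F_j$, the factor $S_j/S_{j+1}$ is nilpotent. If $S_i/S_{i+1}$ is not nilpotent and $C_i=\mathcal M(G,I,\Lambda;P)$ is a Rees matrix semigroup (without zero) over a group $G$, the *pseudo-nilpotent homomorphism* $\Phi_i$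 is the map from $S$ to $(I\times\Lambda)\cup\{\theta\}$ which sends $a\in F_i\cup C_i$ to the unique pair $(e,f)$ such that in $\mathcal N_{S/S_{i+1}}$ the element $a$ is joined to no $(g;e,f)$, $g\in G$, and is joined to all other elements of $C_i$, and which sends all other elements to $\theta$. **Theorem.** Let $S$ be a pseudo-nilpotent finite semigroup with a principal series as above. 1. The union $K$ of all isolated subsets $C_i$ is the largest nilpotent ideal of $S$, and it is the set of all isolated vertices of $\mathcal N_S$ (possibly $K=\emptyset$). 2. If $C_{i_1}\subseteq S^{(i_2)}$ and $C_{i_2}\subseteq S^{(i_3)}$, then $C_{i_1}\subseteq S^{(i_3)}$. If moreover $S_{i_2}/S_{i_2+1}$ and $S_{i_3}/S_{i_3+1}$ are not nilpotent, $C_{i_2}=\mathcal M(G_2,I_2,\Lambda_2;P_2)$ and $C_{i_3}=\mathcal M(G_3,I_3,\Lambda_3;P_3)$, with pseudo-nilpotent homomorphisms $\Phi_2$ and $\Phi_3$, then for every $a\in C_{i_1}$ the values $\Phi_2(a)$ and $\Phi_3(a)$ are well defined and different from $\theta$, and $\Phi_3(a)=\Phi_3\bigl((g;\Phi_2(a))\bigr)$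 for every $g\in G_2$. 3. If $C_i$ is neither an isolated subset nor a root, then there is a root $C_j$ with $i<j$ and $C_i\subseteq S^{(j)}$. 4. $S\setminus K=\bigcup S^{(i)}$, where the union runs over all $i$ such that $C_i$ is a root. 5. Every stem $S^{(i)}$ is a subsemigroup of $S$. 6. $C_iC_j\subseteq K$ if and only if there is no stem that contains both $C_i$ and $C_j$. -/

import Mathlib

open scoped Pointwise

/-- `a c b` computed in `S`, where `c` lies in `S¹`. -/
def sandwich {S : Type*} [Semigroup S] (a : S) (c : WithOne S) (b : S) : S :=
  WithOne.recOneCoe (motive := fun _ => S) (a * b) (fun z => a * z * b) c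

/-- The pair `(λₙ, ρₙ)` of Mal'cev words: `λ₀ = x`, `ρ₀ = y`,
`λₙ₊₁ = λₙ zₙ₊₁ ρₙ`, `ρₙ₊₁ = ρₙ zₙ₊₁ λₙ`. The parameter `zₙ₊₁` is `z n`. -/
def malcevPair {S : Type*} [Semigroup S] (x y : S) (z : ℕ → WithOne S) : ℕ → S × S
  | 0 => (x, y)
  | n + 1 => (sandwich (malcevPair x y z n).1 (z n) (malcevPair x y z n).2,
      sandwich (malcevPair x y z n).2 (z n) (malcevPair x y z n).1)

/-- The word `λₙ(x, y, z₁, …, zₙ)`. -/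
def malcevL {S : Type*} [Semigroup S] (x y : S) (z : ℕ → WithOne S) (n : ℕ) : S :=
  (malcevPair x y z n).1

/-- The word `ρₙ(x, y, z₁, …, zₙ)`. -/
def malcevR {S : Type*} [Semigroup S] (x y : S) (z : ℕ → WithOne S) (n : ℕ) : S :=
  (malcevPair x y z n).2

/-- Nilpotency of a semigroup in the sense of Mal'cev. -/
def IsMalcevNilpotent (S : Type*) [Semigroup S] : Prop :=
  ∃ n : ℕ, 1 ≤ n ∧ ∀ (a b : S) (c : ℕ → WithOne S), malcevL a b c n = malcevR a b c n

/-- The upper non-nilpotent graph `𝒩_S`: there is an edge between `x` and `y` if the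
subsemigroup `⟨x, y⟩` is not nilpotent. -/
def upperNonNilpotentGraph (S : Type*) [Semigroup S] : SimpleGraph S where
  Adj x y := x ≠ y ∧ ¬ IsMalcevNilpotent (Subsemigroup.closure ({x, y} : Set S))
  symm := ⟨fun x y h => ⟨h.1.symm, by rw [Set.pair_comm]; exact h.2⟩⟩
  loopless := ⟨fun _ h => h.1 rfl⟩

/-- A two-sided ideal of a semigroup; the empty set is an ideal. -/
structure SIdeal (S : Type*) [Semigroup S] extends Subsemigroup S where
  mul_mem_left : ∀ (s : S) {t : S}, t ∈ carrier → s * t ∈ carrier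
  mul_mem_right : ∀ {t : S} (s : S), t ∈ carrier → t * s ∈ carrier

instance {S : Type*} [Semigroup S] : SetLike (SIdeal S) S where
  coe I := I.carrier
  coe_injective := by
    rintro ⟨⟨A, _⟩, _, _⟩ ⟨⟨B, _⟩, _, _⟩ h
    cases h
    rfl

/-- The Rees congruence of an ideal (equality if the ideal is empty). -/
def SIdeal.reesCon {S : Type*} [Semigroup S] (I : SIdeal S) : Con S where
  r x y := x = y ∨ (x ∈ I ∧ y ∈ I)
  iseqv :=
    { refl := fun _ => Or.inl rfl
      symm := by
        rintro x y (rfl | h)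
        · exact Or.inl rfl
        · exact Or.inr ⟨h.2, h.1⟩
      trans := by
        rintro x y z (rfl | h) (rfl | h')
        · exact Or.inl rfl
        · exact Or.inr h'
        · exact Or.inr h
        · exact Or.inr ⟨h.1, h'.2⟩ }
  mul' := by
    rintro w x y z (rfl | h) (rfl | h')
    · exact Or.inl rfl
    · exact Or.inr ⟨I.mul_mem_left _ h'.1, I.mul_mem_left _ h'.2⟩
    · exact Or.inr ⟨I.mul_mem_right _ h.1, I.mul_mem_right _ h.2⟩
    · exact Or.inr ⟨I.mul_mem_left _ h'.1, I.mul_mem_left _ h'.2⟩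

/-- The Rees factor semigroup `S / I`; thus `S / ∅ = S`. -/
abbrev SIdeal.ReesFactor {S : Type*} [Semigroup S] (I : SIdeal S) : Type _ :=
  I.reesCon.Quotient

/-- The image of an element of `S` in `S / I`. -/
def SIdeal.toReesFactor {S : Type*} [Semigroup S] (I : SIdeal S) (x : S) : I.ReesFactor :=
  (x : I.reesCon.Quotient)

/-- The ideal `I ∩ T` of a subsemigroup `T`. -/
def SIdeal.restrict {S : Type*} [Semigroup S] (I : SIdeal S) (T : Subsemigroup S) :
    SIdeal T where
  carrier := {x | (x : S) ∈ I}
  mul_mem' := fun ha _ => I.mul_mem_right _ ha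
  mul_mem_left := fun _ _ ht => I.mul_mem_left _ ht
  mul_mem_right := fun _ ht => I.mul_mem_right _ ht

/-- The subsemigroup `⟨x, y, w₁, …, w_m⟩`. Those `wᵢ` that are the adjoined identity
contribute nothing. -/
def wordSubsemigroup {S : Type*} [Semigroup S] (x y : S) (w : ℕ → WithOne S) (m : ℕ) :
    Subsemigroup S :=
  Subsemigroup.closure ({x, y} ∪ {s : S | ∃ k < m, w k = (s : WithOne S)})

theorem sandwich_mem {S : Type*} [Semigroup S] {T : Subsemigroup S} {a b : S}
    {c : WithOne S} (ha : a ∈ T) (hb : b ∈ T) (hc : ∀ s : S, c = (s : WithOne S) → s ∈ T) :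
    sandwich a c b ∈ T := by
  induction c using WithOne.recOneCoe with
  | one => exact T.mul_mem ha hb
  | coe z => exact T.mul_mem (T.mul_mem ha (hc z rfl)) hb

theorem malcevPair_mem {S : Type*} [Semigroup S] (x y : S) (w : ℕ → WithOne S) (m : ℕ) :
    ∀ i, i ≤ m → malcevL x y w i ∈ wordSubsemigroup x y w m ∧
      malcevR x y w i ∈ wordSubsemigroup x y w m := by
  intro i
  induction i with
  | zero =>
    intro _
    exact ⟨Subsemigroup.subset_closure (Or.inl (Or.inl rfl)),
      Subsemigroup.subset_closure (Or.inl (Or.inr rfl))⟩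
  | succ i ih =>
    intro hi
    obtain ⟨h1, h2⟩ := ih (by omega)
    have hw : ∀ s : S, w i = (s : WithOne S) → s ∈ wordSubsemigroup x y w m :=
      fun s hs => Subsemigroup.subset_closure (Or.inr ⟨i, by omega, hs⟩)
    exact ⟨sandwich_mem h1 h2 hw, sandwich_mem h2 h1 hw⟩

/-- `λᵢ(x, y, w₁, …, wᵢ)` as an element of `⟨x, y, w₁, …, w_m⟩`, for `i ≤ m`. -/
def wordL {S : Type*} [Semigroup S] (x y : S) (w : ℕ → WithOne S) {m i : ℕ} (h : i ≤ m) :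
    wordSubsemigroup x y w m :=
  ⟨malcevL x y w i, (malcevPair_mem x y w m i h).1⟩

/-- `ρᵢ(x, y, w₁, …, wᵢ)` as an element of `⟨x, y, w₁, …, w_m⟩`, for `i ≤ m`. -/
def wordR {S : Type*} [Semigroup S] (x y : S) (w : ℕ → WithOne S) {m i : ℕ} (h : i ≤ m) :
    wordSubsemigroup x y w m :=
  ⟨malcevR x y w i, (malcevPair_mem x y w m i h).2⟩

/-- Pseudo-nilpotent semigroups. -/
def IsPseudoNilpotent (S : Type*) [Semigroup S] : Prop :=
  ∀ (x y : S) (t m : ℕ) (w : ℕ → WithOne S) (I : SIdeal (wordSubsemigroup x y w m)),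
    t < m →
    malcevL x y w t ≠ malcevR x y w t →
    malcevL x y w t = malcevL x y w m →
    malcevR x y w t = malcevR x y w m →
    wordL x y w (le_refl m) ∉ I →
    wordR x y w (le_refl m) ∉ I →
    ∀ (i : ℕ) (hi : i ≤ m),
      (upperNonNilpotentGraph I.ReesFactor).Adj
        (I.toReesFactor (wordL x y w hi)) (I.toReesFactor (wordR x y w hi))

/-- A principal series `S = S₁ ⊃ S₂ ⊃ ⋯ ⊃ S_m ⊃ S_{m+1} = ∅` of ideals. The term `S_{k+1}`
is `ideal k` for `k : Fin (m + 1)`, so that the `i`-th step, `i : Fin m`, goes from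
`ideal i.castSucc` down to `ideal i.succ`. -/
structure PrincipalSeries (S : Type*) [Semigroup S] where
  length : ℕ
  ideal : Fin (length + 1) → SIdeal S
  first : (ideal 0 : Set S) = Set.univ
  last : (ideal (Fin.last length) : Set S) = ∅
  strict : ∀ i : Fin length, (ideal i.succ : Set S) ⊂ ideal i.castSucc
  nothing_between : ∀ (i : Fin length) (J : SIdeal S),
    ¬ ((ideal i.succ : Set S) ⊂ J ∧ (J : Set S) ⊂ ideal i.castSucc)

namespace PrincipalSeries

variable {S : Type*} [Semigroup S] (P : PrincipalSeries S)

/-- The upper ideal `S_i` of the `i`-th step. -/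
def upper (i : Fin P.length) : SIdeal S := P.ideal i.castSucc

/-- The lower ideal `S_{i+1}` of the `i`-th step. -/
def lower (i : Fin P.length) : SIdeal S := P.ideal i.succ

/-- The principal class `S_i \ S_{i+1}`. -/
def cls (i : Fin P.length) : Set S := (P.upper i : Set S) \ P.lower i

/-- The principal factor `S_i / S_{i+1}` is nilpotent. -/
def FactorNilpotent (i : Fin P.length) : Prop :=
  IsMalcevNilpotent ((P.lower i).restrict (P.upper i).toSubsemigroup).ReesFactor

/-- `F_J` for the ideal `J = S_i / S_{i+1}` of `S / S_{i+1}`, its (non-zero) elements being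
identified with elements of `S \ S_{i+1}`: the elements of `S \ S_i` with a non-zero product
with some element of `J`. A product is zero in `S / S_{i+1}` when it lies in `S_{i+1}`; in
the last step, `S_{i+1} = ∅`, the zero is an adjoined one, and no product is zero. -/
def actors (i : Fin P.length) : Set S :=
  {s | s ∉ P.upper i ∧ ∃ x ∈ P.cls i, s * x ∉ P.lower i ∨ x * s ∉ P.lower i}

/-- `S_i \ S_{i+1}` is a root. -/
def IsRoot (i : Fin P.length) : Prop :=
  ¬ P.FactorNilpotent i ∧
    ∀ a ∈ P.cls i, ∀ b ∈ P.lower i, ¬ (upperNonNilpotentGraph S).Adj a b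

/-- `S_i \ S_{i+1}` is an isolated subset. -/
def IsIsolatedClass (i : Fin P.length) : Prop :=
  ¬ P.IsRoot i ∧ ∀ j : Fin P.length, P.cls i ⊆ P.actors j → P.FactorNilpotent j

/-- The index set `i*`. -/
def starIndex (i : Fin P.length) : Set (Fin P.length) :=
  {j | j ≤ i ∧ P.cls j ⊆ P.actors i ∪ P.cls i}

/-- The set `S^{(i)}`; it is called a stem if `S_i \ S_{i+1}` is a root. -/
def stem (i : Fin P.length) : Set S := ⋃ j ∈ P.starIndex i, P.cls j

/-- The union `K` of the isolated subsets. -/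
def isolatedUnion : Set S := ⋃ (i : Fin P.length) (_ : P.IsIsolatedClass i), P.cls i

end PrincipalSeries

/-- The Rees matrix semigroup `ℳ(G, I, Λ; P)` without zero over a group `G`, with elements
`(g; i, l)` and product `(g; i, l)(h; j, m) = (g p_{l,j} h; i, m)`. -/
@[ext]
structure ReesMatrix {G I Λ : Type*} (p : Λ → I → G) where
  elt : G
  row : I
  col : Λ

instance {G I Λ : Type*} [Group G] (p : Λ → I → G) : Semigroup (ReesMatrix p) where
  mul x y := ⟨x.elt * p x.col y.row * y.elt, x.row, y.col⟩
  mul_assoc x y z := by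
    apply ReesMatrix.ext
    · change x.elt * p x.col y.row * y.elt * p y.col z.row * z.elt =
        x.elt * p x.col y.row * (y.elt * p y.col z.row * z.elt)
      simp only [mul_assoc]
    · rfl
    · rfl

/-- A presentation `S_i \ S_{i+1} = ℳ(G, I, Λ; P)`. -/
structure ReesPresentation {S : Type*} [Semigroup S] (P : PrincipalSeries S)
    (i : Fin P.length) (G I Λ : Type*) [Group G] where
  mat : Λ → I → G
  toHom : ReesMatrix mat →ₙ* S
  injective : Function.Injective toHom
  range_eq : Set.range toHom = P.cls i

namespace ReesPresentation

variable {S : Type*} [Semigroup S] {P : PrincipalSeries S} {i : Fin P.length}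
  {G I Λ : Type*} [Group G] (R : ReesPresentation P i G I Λ)

/-- The element `(g; e, f)` of `S_i \ S_{i+1}`, where `q = (e, f)`. -/
def el (g : G) (q : I × Λ) : S := R.toHom ⟨g, q.1, q.2⟩

/-- In the upper non-nilpotent graph of `S / S_{i+1}`, the element `a` is not joined to any
`(g; q)` and is joined to all other elements of `S_i \ S_{i+1}`. There is at most one such
`q`. -/
def IsPairOf (a : S) (q : I × Λ) : Prop :=
  (∀ g : G, ¬ (upperNonNilpotentGraph (P.lower i).ReesFactor).Adj
      ((P.lower i).toReesFactor a) ((P.lower i).toReesFactor (R.el g q))) ∧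
  ∀ q' : I × Λ, q' ≠ q → ∀ g : G,
    (upperNonNilpotentGraph (P.lower i).ReesFactor).Adj
      ((P.lower i).toReesFactor a) ((P.lower i).toReesFactor (R.el g q'))

open Classical in
/-- The pseudo-nilpotent homomorphism `Φ_i : (S / S_{i+1})⁰ → (I × Λ)⁰`, composed with the
projection of `S`: an element of `F_J ∪ (J \ {θ})`, where `J = S_i / S_{i+1}`, is sent to the
unique pair `q` as in `IsPairOf`, all others to zero. -/
noncomputable def Phi (a : S) : WithZero (I × Λ) :=
  if h : a ∈ P.actors i ∪ P.cls i ∧ ∃ q, R.IsPairOf a q then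
    ((Classical.choose h.2 : I × Λ) : WithZero (I × Λ))
  else 0

end ReesPresentation

/-!
A finite semigroup `T` is not nilpotent modulo an ideal `L` exactly when some pair of elements
*survives*: the Mal'cev words `λₙ`, `ρₙ`, for suitable parameters, stay distinct and outside `L`
forever (`not_isMalcevNilpotent_iff_survives`). Pseudo-nilpotency then says that a pair `x`, `y`
survives modulo `L`, with parameters anywhere in `S`, only if `⟨x, y⟩` is already not nilpotent
modulo `L` (`HasLocalSurvivors`). This is exploited by exhibiting surviving pairs which generate
nilpotent subsemigroups.

* If `e h = h e`, then `⟨e, h⟩` is commutative, so `(h, e)` does not survive, and by left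
  translation neither does `(x h, x e)`. Hence `ℋ`-related elements never survive
  (`not_survives_of_rRel_lRel`); for a group this is a proof of nilpotency.
* If the principal factor of a class `C` is not nilpotent, then `C` contains a surviving pair, whose
  members are not `ℋ`-related. If `C` had zero divisors, there would be a surviving pair in `C` for
  which `⟨x, y⟩` is nilpotent (`IsRegularBlock.mul_mem_of_linked`). So `C` is completely simple.
* The elements with a non-zero product with an element of `C` form a subsemigroup, `actingSet C`,
  whose complement is an ideal. Each such element maps all of `C` to one `ℛ`-class and one
  `ℒ`-class (`IsSimpleBlock.exists_sameAction`); this is the pseudo-nilpotent homomorphism.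
* Surviving pairs lie in classes of this kind, so `x` and `y` are joined in the graph if and only
  if they act differently on some such class (`PrincipalSeries.adj_iff`).

For classes with non-nilpotent factor the acting sets are the sets `S⁽ⁱ⁾`. The roots are the classes
with maximal acting set, and `K` is the complement of the union of all acting sets. The theorem
follows from these descriptions, since a product lies in an acting set exactly when both factors do.
-/

/-! ### Surviving pairs -/

section Survivors

variable {S : Type*} [Semigroup S] {L T : Set S} {x y : S}

/-- The pair `(x, y)` survives modulo `L` with parameters in `T¹`: for some choice of the
parameters the Mal'cev words `λₙ`, `ρₙ` are distinct and outside `L` for all `n`. For a finite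
semigroup `T` and an ideal `L`, the Rees factor of `T` by `L` fails to be nilpotent exactly when
some pair of elements of `T` survives. -/
def Survives (L T : Set S) (x y : S) : Prop :=
  ∃ w : ℕ → WithOne S, (∀ (n : ℕ) (s : S), w n = (s : WithOne S) → s ∈ T) ∧
    ∀ n, malcevL x y w n ≠ malcevR x y w n ∧ malcevL x y w n ∉ L ∧ malcevR x y w n ∉ L

theorem malcevPair_succ' (x y : S) (w : ℕ → WithOne S) (n : ℕ) :
    malcevPair x y w (n + 1) =
      malcevPair (sandwich x (w 0) y) (sandwich y (w 0) x) (fun k => w (k + 1)) n := by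
  induction n with
  | zero => rfl
  | succ n ih =>
    rw [malcevPair, ih]
    rfl

/-- Coinduction principle for surviving pairs. -/
theorem Survives.of_invariant (Q : S → S → Prop)
    (h : ∀ x y, Q x y → x ≠ y ∧ x ∉ L ∧ y ∉ L ∧
      ∃ c : WithOne S, (∀ s : S, c = (s : WithOne S) → s ∈ T) ∧
        Q (sandwich x c y) (sandwich y c x))
    (hxy : Q x y) : Survives L T x y := by
  choose! c hcT hcQ using fun x y hq => (h x y hq).2.2.2
  let p : ℕ → S × S := fun n =>
    Nat.rec (x, y) (fun _ q => (sandwich q.1 (c q.1 q.2) q.2, sandwich q.2 (c q.1 q.2) q.1)) n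
  have hp : ∀ n, Q (p n).1 (p n).2 := by
    intro n
    induction n with
    | zero => exact hxy
    | succ n ih => exact hcQ _ _ ih
  have hw : ∀ n, malcevPair x y (fun n => c (p n).1 (p n).2) n = p n := by
    intro n
    induction n with
    | zero => rfl
    | succ n ih => rw [malcevPair, ih]
  refine ⟨fun n => c (p n).1 (p n).2, fun n s hs => hcT _ _ (hp n) s hs, fun n => ?_⟩
  rw [malcevL, malcevR, hw]
  exact ⟨(h _ _ (hp n)).1, (h _ _ (hp n)).2.1, (h _ _ (hp n)).2.2.1⟩

theorem Survives.ne (h : Survives L T x y) : x ≠ y := by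
  obtain ⟨w, -, h⟩ := h
  exact (h 0).1

theorem Survives.notMem_left (h : Survives L T x y) : x ∉ L := by
  obtain ⟨w, -, h⟩ := h
  exact (h 0).2.1

theorem Survives.notMem_right (h : Survives L T x y) : y ∉ L := by
  obtain ⟨w, -, h⟩ := h
  exact (h 0).2.2

theorem Survives.step (h : Survives L T x y) :
    ∃ c : WithOne S, (∀ s : S, c = (s : WithOne S) → s ∈ T) ∧
      Survives L T (sandwich x c y) (sandwich y c x) := by
  obtain ⟨w, hT, h⟩ := h
  refine ⟨w 0, hT 0, fun k => w (k + 1), fun n => hT (n + 1), fun n => ?_⟩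
  have := h (n + 1)
  rwa [malcevL, malcevR, malcevPair_succ'] at this

theorem Survives.mono {L' T' : Set S} (hL : L' ⊆ L) (hT : T ⊆ T') (h : Survives L T x y) :
    Survives L' T' x y := by
  obtain ⟨w, hw, h⟩ := h
  exact ⟨w, fun n s hs => hT (hw n s hs), fun n =>
    ⟨(h n).1, fun h' => (h n).2.1 (hL h'), fun h' => (h n).2.2 (hL h')⟩⟩

theorem Survives.symm (h : Survives L T x y) : Survives L T y x := by
  refine Survives.of_invariant (fun p q => Survives L T q p) (fun p q hpq => ?_) h
  obtain ⟨c, hc, hs⟩ := hpq.step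
  exact ⟨hpq.ne.symm, hpq.notMem_right, hpq.notMem_left, c, hc, hs⟩

@[simp] theorem sandwich_one (x y : S) : sandwich x 1 y = x * y := rfl

@[simp] theorem sandwich_coe (x c y : S) : sandwich x (c : WithOne S) y = x * c * y := rfl

/-- A pair of elements survives if one parameter carries it to a surviving pair. -/
theorem Survives.of_step {c : S} (hc : c ∈ T)
    (h : Survives ∅ T (x * c * y) (y * c * x)) : Survives ∅ T x y := by
  refine Survives.of_invariant (fun p q => (p = x ∧ q = y) ∨ Survives ∅ T p q) ?_
    (Or.inl ⟨rfl, rfl⟩)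
  rintro p q (⟨rfl, rfl⟩ | hpq)
  · refine ⟨fun hpq => h.ne (by rw [hpq]), id, id, c, fun s hs => ?_, Or.inr h⟩
    rw [WithOne.coe_inj] at hs
    exact hs ▸ hc
  · obtain ⟨c, hc, h⟩ := hpq.step
    exact ⟨hpq.ne, id, id, c, hc, Or.inr h⟩

theorem sandwich_map {A B : Type*} [Semigroup A] [Semigroup B] (f : A →ₙ* B) (a b : A)
    (c : WithOne A) :
    sandwich (f a) (WithOne.map f c) (f b) = f (sandwich a c b) := by
  induction c using WithOne.recOneCoe with
  | one => exact (map_mul f a b).symm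
  | coe c => rw [WithOne.map_coe, sandwich_coe, sandwich_coe, map_mul, map_mul]

theorem malcevPair_map {A B : Type*} [Semigroup A] [Semigroup B] (f : A →ₙ* B) (a b : A)
    (w : ℕ → WithOne A) (n : ℕ) :
    malcevPair (f a) (f b) (fun n => WithOne.map f (w n)) n =
      (f (malcevL a b w n), f (malcevR a b w n)) := by
  induction n with
  | zero => rfl
  | succ n ih =>
    rw [malcevPair, ih, sandwich_map, sandwich_map]
    rfl

/-- In a finite semigroup a sufficiently long path of admissible pairs must repeat, so it can
be continued forever. -/
theorem Survives.of_finite_path [Fintype S] (w : ℕ → WithOne S)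
    (hT : ∀ (n : ℕ) (s : S), w n = (s : WithOne S) → s ∈ T)
    (h : ∀ n ≤ Fintype.card (S × S),
      malcevL x y w n ≠ malcevR x y w n ∧ malcevL x y w n ∉ L ∧ malcevR x y w n ∉ L) :
    Survives L T x y := by
  obtain ⟨i, j, hij, he⟩ := Fintype.exists_ne_map_eq_of_card_lt
    (fun k : Fin (Fintype.card (S × S) + 1) => malcevPair x y w k) (by simp)
  wlog hlt : i < j generalizing i j
  · exact this j i hij.symm he.symm (lt_of_le_of_ne (not_lt.mp hlt) hij.symm)
  have hlt' : (i : ℕ) < j := hlt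
  have hj : (j : ℕ) ≤ Fintype.card (S × S) := Nat.lt_succ_iff.mp j.2
  refine Survives.of_invariant
    (fun p q => ∃ k < (j : ℕ), p = malcevL x y w k ∧ q = malcevR x y w k) ?_ ⟨0, by omega, rfl, rfl⟩
  rintro _ _ ⟨k, hk, rfl, rfl⟩
  obtain ⟨h1, h2, h3⟩ := h k (by omega)
  refine ⟨h1, h2, h3, w k, hT k, ?_⟩
  rcases Nat.lt_or_ge (k + 1) j with hk' | hk'
  · exact ⟨k + 1, hk', rfl, rfl⟩
  · have hkj : k + 1 = j := by omega
    refine ⟨i, hlt, ?_, ?_⟩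
    · change malcevL x y w (k + 1) = _
      rw [hkj]
      exact (congrArg Prod.fst he).symm
    · change malcevR x y w (k + 1) = _
      rw [hkj]
      exact (congrArg Prod.snd he).symm

theorem sandwich_mem_ideal_left (hL : ∀ s, ∀ t ∈ L, s * t ∈ L ∧ t * s ∈ L) {a b : S}
    (c : WithOne S) (ha : a ∈ L) : sandwich a c b ∈ L := by
  induction c using WithOne.recOneCoe with
  | one => exact (hL b a ha).2
  | coe c => exact (hL b _ (hL c a ha).2).2

theorem sandwich_mem_ideal_right (hL : ∀ s, ∀ t ∈ L, s * t ∈ L ∧ t * s ∈ L) {a b : S}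
    (c : WithOne S) (hb : b ∈ L) : sandwich a c b ∈ L := by
  induction c using WithOne.recOneCoe with
  | one => exact (hL a b hb).1
  | coe c => exact (hL (a * c) b hb).1

/-- A Rees factor of a finite semigroup `A` fails to be nilpotent if and only if some pair of
elements of `A` survives. The Rees factor is given by a surjective homomorphism `π` with the
appropriate kernel. -/
theorem not_isMalcevNilpotent_iff_survives [Finite S]
    (hL : ∀ s, ∀ t ∈ L, s * t ∈ L ∧ t * s ∈ L) (A : Subsemigroup S)
    {Q : Type*} [Semigroup Q] (π : A →ₙ* Q) (hπ : Function.Surjective π)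
    (hker : ∀ x y : A, π x = π y ↔ x = y ∨ ((x : S) ∈ L ∧ (y : S) ∈ L)) :
    ¬ IsMalcevNilpotent Q ↔ ∃ a ∈ A, ∃ b ∈ A, Survives L (A : Set S) a b := by
  cases nonempty_fintype S
  constructor
  · intro h
    unfold IsMalcevNilpotent at h
    push Not at h
    obtain ⟨a, b, c, hne⟩ := h (Fintype.card (S × S) + 1) (by omega)
    obtain ⟨a, rfl⟩ := hπ a
    obtain ⟨b, rfl⟩ := hπ b
    obtain ⟨g, hg⟩ := hπ.hasRightInverse
    let w : ℕ → WithOne A := fun n => WithOne.map g (c n)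
    have hw : c = fun n => WithOne.map π (w n) := by
      funext n
      cases h' : c n using WithOne.recOneCoe with
      | one => simp only [w, h']; rfl
      | coe q => simp only [w, h', WithOne.map_coe, hg q]
    rw [hw] at hne
    have hneq : ∀ n ≤ Fintype.card (S × S) + 1,
        π (malcevL a b w n) ≠ π (malcevR a b w n) := by
      intro n hn heq
      have key : ∀ k, malcevL (π a) (π b) (fun n => WithOne.map π (w n)) (n + k) =
          malcevR (π a) (π b) (fun n => WithOne.map π (w n)) (n + k) := by
        intro k
        induction k with
        | zero => simpa only [malcevL, malcevR, malcevPair_map, add_zero] using heq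
        | succ k ih =>
          change sandwich _ _ _ = sandwich _ _ _
          change (malcevPair _ _ _ _).1 = (malcevPair _ _ _ _).2 at ih
          simp only [Nat.add_eq, ih]
      have := key (Fintype.card (S × S) + 1 - n)
      rw [Nat.add_sub_cancel' hn] at this
      exact hne this
    have hS : ∀ n, malcevPair (a : S) b (fun n => WithOne.map (MulMemClass.subtype A) (w n)) n =
        (↑(malcevL a b w n), ↑(malcevR a b w n)) := malcevPair_map (MulMemClass.subtype A) a b w
    refine ⟨a, a.2, b, b.2, Survives.of_finite_path
      (fun n => WithOne.map (MulMemClass.subtype A) (w n)) ?_ ?_⟩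
    · intro n s hs
      cases h' : w n using WithOne.recOneCoe with
      | one =>
        rw [h'] at hs
        exact absurd hs WithOne.one_ne_coe
      | coe q =>
        rw [h', WithOne.map_coe, WithOne.coe_inj] at hs
        rw [← hs]
        exact q.2
    · intro n hn
      simp only [malcevL, malcevR, hS]
      have h1 := hneq n (by omega)
      have h2 := hneq (n + 1) (by omega)
      rw [Ne, hker, not_or] at h1 h2
      have h3 : ∀ u v : A, ((sandwich u (w n) v : A) : S) =
          sandwich (u : S) (WithOne.map (MulMemClass.subtype A) (w n)) v :=
        fun u v => (sandwich_map (MulMemClass.subtype A) u v (w n)).symm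
      have h4 : ((malcevL a b w (n + 1) : A) : S) = sandwich ((malcevL a b w n : A) : S)
        (WithOne.map (MulMemClass.subtype A) (w n)) (malcevR a b w n : A) := h3 _ _
      have h5 : ((malcevR a b w (n + 1) : A) : S) = sandwich ((malcevR a b w n : A) : S)
        (WithOne.map (MulMemClass.subtype A) (w n)) (malcevL a b w n : A) := h3 _ _
      refine ⟨fun h => h1.1 (Subtype.ext h), fun h => h2.2 ⟨?_, ?_⟩, fun h => h2.2 ⟨?_, ?_⟩⟩
      · rw [h4]; exact sandwich_mem_ideal_left hL _ h
      · rw [h5]; exact sandwich_mem_ideal_right hL _ h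
      · rw [h4]; exact sandwich_mem_ideal_right hL _ h
      · rw [h5]; exact sandwich_mem_ideal_left hL _ h
  · rintro ⟨a, ha, b, hb, w, hw, h⟩ ⟨n, -, hn⟩
    have : ∀ n, ∃ c : WithOne A, WithOne.map (MulMemClass.subtype A) c = w n := by
      intro n
      cases h' : w n using WithOne.recOneCoe with
      | one => exact ⟨1, rfl⟩
      | coe q => exact ⟨((⟨q, hw n q h'⟩ : A) : WithOne A), rfl⟩
    choose c hc using this
    have hS : malcevPair a b w n =
        (↑(malcevL ⟨a, ha⟩ ⟨b, hb⟩ c n), ↑(malcevR ⟨a, ha⟩ ⟨b, hb⟩ c n)) := by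
      rw [← funext hc]
      exact malcevPair_map (MulMemClass.subtype A) ⟨a, ha⟩ ⟨b, hb⟩ c n
    have h1 := hn (π ⟨a, ha⟩) (π ⟨b, hb⟩) (fun n => WithOne.map π (c n))
    simp only [malcevL, malcevR, malcevPair_map] at h1
    have h2 := h n
    simp only [malcevL, malcevR, hS] at h2
    rcases (hker _ _).1 h1 with h3 | h3
    · exact h2.1 (congrArg Subtype.val h3)
    · exact h2.2.1 h3.1

theorem not_isMalcevNilpotent_coe_iff_survives [Finite S] (A : Subsemigroup S) :
    ¬ IsMalcevNilpotent A ↔ ∃ a ∈ A, ∃ b ∈ A, Survives ∅ (A : Set S) a b :=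
  not_isMalcevNilpotent_iff_survives (by simp) A (MulHom.id A) Function.surjective_id
    (by simp)

/-- The case of a subsemigroup generated by two elements of the image of a homomorphism `f`. -/
theorem not_isMalcevNilpotent_closure_iff_survives [Finite S]
    (hL : ∀ s, ∀ t ∈ L, s * t ∈ L ∧ t * s ∈ L) (A : Subsemigroup S)
    {Q : Type*} [Semigroup Q] (f : A →ₙ* Q)
    (hker : ∀ x y : A, f x = f y ↔ x = y ∨ ((x : S) ∈ L ∧ (y : S) ∈ L)) (x y : A) :
    ¬ IsMalcevNilpotent (Subsemigroup.closure ({f x, f y} : Set Q)) ↔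
      ∃ a ∈ Subsemigroup.closure ({(x : S), (y : S)} : Set S),
        ∃ b ∈ Subsemigroup.closure ({(x : S), (y : S)} : Set S),
          Survives L (Subsemigroup.closure ({(x : S), (y : S)} : Set S) : Set S) a b := by
  have hle : Subsemigroup.closure ({(x : S), (y : S)} : Set S) ≤ A := by
    rw [Subsemigroup.closure_le]
    rintro _ (rfl | rfl)
    exacts [x.2, y.2]
  have hmem : ∀ z : Subsemigroup.closure ({(x : S), (y : S)} : Set S),
      f ⟨z, hle z.2⟩ ∈ Subsemigroup.closure ({f x, f y} : Set Q) := by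
    rintro ⟨z, hz⟩
    induction hz using Subsemigroup.closure_induction with
    | mem z hz =>
      apply Subsemigroup.subset_closure
      rcases hz with rfl | rfl
      exacts [Or.inl rfl, Or.inr rfl]
    | mul u v hu hv ihu ihv =>
      have := Subsemigroup.mul_mem _ ihu ihv
      rwa [← map_mul] at this
  let π : Subsemigroup.closure ({(x : S), (y : S)} : Set S) →ₙ*
      Subsemigroup.closure ({f x, f y} : Set Q) :=
    { toFun := fun z => ⟨f ⟨z, hle z.2⟩, hmem z⟩
      map_mul' := fun u v => Subtype.ext (map_mul f ⟨u, hle u.2⟩ ⟨v, hle v.2⟩) }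
  refine not_isMalcevNilpotent_iff_survives hL _ π ?_ ?_
  · rintro ⟨q, hq⟩
    induction hq using Subsemigroup.closure_induction with
    | mem q hq =>
      rcases hq with rfl | rfl
      · exact ⟨⟨x, Subsemigroup.subset_closure (Or.inl rfl)⟩, rfl⟩
      · exact ⟨⟨y, Subsemigroup.subset_closure (Or.inr rfl)⟩, rfl⟩
    | mul u v hu hv ihu ihv =>
      obtain ⟨u', hu'⟩ := ihu
      obtain ⟨v', hv'⟩ := ihv
      exact ⟨u' * v', by rw [map_mul, hu', hv']; rfl⟩
  · intro u v
    rw [Subtype.ext_iff]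
    refine (hker _ _).trans ?_
    simp only [Subtype.ext_iff]

/-- The consequence of pseudo-nilpotency used below: if a pair survives modulo an ideal `L`,
then modulo `L` it generates a subsemigroup that is not nilpotent. -/
def HasLocalSurvivors (S : Type*) [Semigroup S] : Prop :=
  ∀ L : Set S, (∀ s, ∀ t ∈ L, s * t ∈ L ∧ t * s ∈ L) → ∀ x y : S, Survives L Set.univ x y →
    ∃ a ∈ Subsemigroup.closure ({x, y} : Set S), ∃ b ∈ Subsemigroup.closure ({x, y} : Set S),
      Survives L (Subsemigroup.closure ({x, y} : Set S) : Set S) a b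

/-- The canonical homomorphism onto a Rees factor. -/
def SIdeal.toReesHom (I : SIdeal S) : S →ₙ* I.ReesFactor where
  toFun := I.toReesFactor
  map_mul' _ _ := rfl

theorem SIdeal.toReesFactor_eq_iff (I : SIdeal S) {x y : S} :
    I.toReesFactor x = I.toReesFactor y ↔ x = y ∨ (x ∈ I ∧ y ∈ I) :=
  Con.eq I.reesCon

theorem IsPseudoNilpotent.hasLocalSurvivors [Finite S] (hS : IsPseudoNilpotent S) :
    HasLocalSurvivors S := by
  rintro L hL x y ⟨w, -, hw⟩
  obtain ⟨i, j, hij, he⟩ := Finite.exists_ne_map_eq_of_infinite (malcevPair x y w)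
  wlog hlt : i < j generalizing i j
  · exact this j i hij.symm he.symm (lt_of_le_of_ne (not_lt.mp hlt) hij.symm)
  let I : SIdeal S :=
    { carrier := L
      mul_mem' := fun {a b} _ hb => (hL a b hb).1
      mul_mem_left := fun s t ht => (hL s t ht).1
      mul_mem_right := fun s ht => (hL s _ ht).2 }
  have h := hS x y i j w (I.restrict (wordSubsemigroup x y w j)) hlt (hw i).1
    (congrArg Prod.fst he) (congrArg Prod.snd he) (hw j).2.1 (hw j).2.2 0 (Nat.zero_le _)
  exact (not_isMalcevNilpotent_closure_iff_survives hL (wordSubsemigroup x y w j)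
    (I.restrict (wordSubsemigroup x y w j)).toReesHom
    (fun u v => SIdeal.toReesFactor_eq_iff _) (wordL x y w (Nat.zero_le _))
    (wordR x y w (Nat.zero_le _))).1 h.2

end Survivors

/-! ### Passing to the opposite semigroup -/

section Opposite

open MulOpposite

variable {S : Type*} [Semigroup S] {L T : Set S} {x y : S}

theorem Survives.op (h : Survives L T x y) :
    Survives (unop ⁻¹' L) (unop ⁻¹' T) (op x) (op y) := by
  refine Survives.of_invariant (fun p q => Survives L T (unop p) (unop q)) (fun p q hpq => ?_) h
  obtain ⟨c, hc, hs⟩ := hpq.step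
  refine ⟨fun h => hpq.ne (congrArg unop h), hpq.notMem_left, hpq.notMem_right, ?_⟩
  induction c using WithOne.recOneCoe with
  | one => exact ⟨1, fun s hs => absurd hs WithOne.one_ne_coe, hs.symm⟩
  | coe c =>
    refine ⟨(MulOpposite.op c : Sᵐᵒᵖ), fun s hs => ?_, ?_⟩
    · rw [WithOne.coe_inj] at hs
      rw [← hs]
      exact hc c rfl
    · have := hs.symm
      simpa only [sandwich_coe, unop_mul, unop_op, mul_assoc] using this

theorem Survives.unop {L T : Set Sᵐᵒᵖ} {x y : Sᵐᵒᵖ} (h : Survives L T x y) :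
    Survives (MulOpposite.op ⁻¹' L) (MulOpposite.op ⁻¹' T) (MulOpposite.unop x)
      (MulOpposite.unop y) := by
  refine Survives.of_invariant (fun p q => Survives L T (MulOpposite.op p) (MulOpposite.op q))
    (fun p q hpq => ?_) h
  obtain ⟨c, hc, hs⟩ := hpq.step
  refine ⟨fun h => hpq.ne (congrArg MulOpposite.op h), hpq.notMem_left, hpq.notMem_right, ?_⟩
  induction c using WithOne.recOneCoe with
  | one => exact ⟨1, fun s hs => absurd hs WithOne.one_ne_coe, hs.symm⟩
  | coe c =>
    refine ⟨(MulOpposite.unop c : S), fun s hs => ?_, ?_⟩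
    · rw [WithOne.coe_inj] at hs
      rw [← hs]
      exact hc c rfl
    · have := hs.symm
      simpa only [sandwich_coe, op_mul, op_unop, mul_assoc] using this

theorem op_mem_closure_pair_iff {a : S} :
    op a ∈ Subsemigroup.closure ({op x, op y} : Set Sᵐᵒᵖ) ↔
      a ∈ Subsemigroup.closure ({x, y} : Set S) := by
  constructor
  · suffices ∀ b : Sᵐᵒᵖ, b ∈ Subsemigroup.closure ({op x, op y} : Set Sᵐᵒᵖ) →
        unop b ∈ Subsemigroup.closure ({x, y} : Set S) from this (op a)
    intro b hb
    induction hb using Subsemigroup.closure_induction with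
    | mem b hb =>
      apply Subsemigroup.subset_closure
      rcases hb with rfl | rfl
      exacts [Or.inl rfl, Or.inr rfl]
    | mul u v hu hv ihu ihv => exact Subsemigroup.mul_mem _ ihv ihu
  · intro ha
    induction ha using Subsemigroup.closure_induction with
    | mem b hb =>
      apply Subsemigroup.subset_closure
      rcases hb with rfl | rfl
      exacts [Or.inl rfl, Or.inr rfl]
    | mul u v hu hv ihu ihv => exact Subsemigroup.mul_mem _ ihv ihu

theorem HasLocalSurvivors.op (hS : HasLocalSurvivors S) : HasLocalSurvivors Sᵐᵒᵖ := by
  intro L hL x y h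
  obtain ⟨a, ha, b, hb, hab⟩ := hS (MulOpposite.op ⁻¹' L)
    (fun s t ht => ⟨(hL (MulOpposite.op s) _ ht).2, (hL (MulOpposite.op s) _ ht).1⟩) _ _ h.unop
  refine ⟨MulOpposite.op a, op_mem_closure_pair_iff.2 ha, MulOpposite.op b,
    op_mem_closure_pair_iff.2 hb, hab.op.mono (fun _ h => h) fun s hs => ?_⟩
  exact (op_mem_closure_pair_iff (a := MulOpposite.unop s)).2 hs

end Opposite

/-! ### Green's relations and idempotents -/

section Green

variable {S : Type*} [Semigroup S] {x y z : S}

/-- Green's relation `ℛ`, in the form `x S = y S ∋ x, y`: each of `x`, `y` is a right multiple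
of the other. On regular elements this is the usual relation. -/
def RRel (x y : S) : Prop := (∃ s, x * s = y) ∧ ∃ t, y * t = x

/-- Green's relation `ℒ`: each of `x`, `y` is a left multiple of the other. -/
def LRel (x y : S) : Prop := (∃ s, s * x = y) ∧ ∃ t, t * y = x

theorem RRel.symm (h : RRel x y) : RRel y x := ⟨h.2, h.1⟩

theorem LRel.symm (h : LRel x y) : LRel y x := ⟨h.2, h.1⟩

theorem RRel.trans (h : RRel x y) (h' : RRel y z) : RRel x z := by
  obtain ⟨⟨s, rfl⟩, t, ht⟩ := h
  obtain ⟨⟨s', rfl⟩, t', ht'⟩ := h'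
  exact ⟨⟨s * s', by rw [mul_assoc]⟩, t' * t, by rw [← mul_assoc, ht', ht]⟩

theorem LRel.trans (h : LRel x y) (h' : LRel y z) : LRel x z := by
  obtain ⟨⟨s, rfl⟩, t, ht⟩ := h
  obtain ⟨⟨s', rfl⟩, t', ht'⟩ := h'
  exact ⟨⟨s' * s, by rw [mul_assoc]⟩, t * t', by rw [mul_assoc, ht', ht]⟩

theorem RRel.mul_left (h : RRel x y) (s : S) : RRel (s * x) (s * y) := by
  obtain ⟨⟨u, rfl⟩, t, ht⟩ := h
  exact ⟨⟨u, mul_assoc s x u⟩, t, by rw [mul_assoc, ht]⟩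

theorem LRel.mul_right (h : LRel x y) (s : S) : LRel (x * s) (y * s) := by
  obtain ⟨⟨u, rfl⟩, t, ht⟩ := h
  exact ⟨⟨u, (mul_assoc u x s).symm⟩, t, by rw [← mul_assoc, ht]⟩

theorem LRel.op (h : LRel x y) : RRel (MulOpposite.op x) (MulOpposite.op y) := by
  obtain ⟨⟨s, rfl⟩, t, ht⟩ := h
  exact ⟨⟨MulOpposite.op s, rfl⟩, MulOpposite.op t, congrArg MulOpposite.op ht⟩

theorem RRel.unop (h : RRel (MulOpposite.op x) (MulOpposite.op y)) : LRel x y := by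
  obtain ⟨⟨s, hs⟩, t, ht⟩ := h
  exact ⟨⟨MulOpposite.unop s, congrArg MulOpposite.unop hs⟩, MulOpposite.unop t,
    congrArg MulOpposite.unop ht⟩

theorem exists_idempotent_mem_closure [Finite S] (s : S) :
    ∃ e ∈ Subsemigroup.closure ({s} : Set S), e * e = e := by
  let : TopologicalSpace S := ⊥
  have : DiscreteTopology S := ⟨rfl⟩
  exact exists_idempotent_in_compact_subsemigroup (fun _ => continuous_of_discreteTopology)
    (Subsemigroup.closure ({s} : Set S) : Set S)
    ⟨s, Subsemigroup.subset_closure rfl⟩ (Set.toFinite _).isCompact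
    (fun a ha b hb => Subsemigroup.mul_mem _ ha hb)

/-- If `x = u x s`, then some idempotent power of `s` fixes `x` from the right. -/
theorem exists_idempotent_mul_eq [Finite S] {u : WithOne S} {s : S}
    (h : (x : WithOne S) = u * x * s) :
    ∃ e ∈ Subsemigroup.closure ({s} : Set S), e * e = e ∧ x * e = x := by
  obtain ⟨e, he, hee⟩ := exists_idempotent_mem_closure s
  refine ⟨e, he, hee, ?_⟩
  have key : ∀ r ∈ Subsemigroup.closure ({s} : Set S),
      ∃ u : WithOne S, (x : WithOne S) = u * x * r := by
    intro r hr
    induction hr using Subsemigroup.closure_induction with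
    | mem r hr =>
      rcases hr with rfl
      exact ⟨u, h⟩
    | mul p q hp hq ihp ihq =>
      obtain ⟨a, ha⟩ := ihp
      obtain ⟨b, hb⟩ := ihq
      refine ⟨b * a, ?_⟩
      rw [WithOne.coe_mul]
      calc (x : WithOne S) = b * (a * x * p) * q := by rw [← ha, ← hb]
        _ = b * a * x * (p * q) := by simp only [mul_assoc]
  obtain ⟨v, hv⟩ := key e he
  apply WithOne.coe_injective
  rw [WithOne.coe_mul, hv, mul_assoc, ← WithOne.coe_mul, hee]

theorem exists_eq_mul_of_mem_closure {s e : S} (he : e ∈ Subsemigroup.closure ({s} : Set S))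
    (hee : e * e = e) : ∃ t, e = s * t := by
  have key : ∀ r ∈ Subsemigroup.closure ({s} : Set S), ∀ q : S, ∃ t, r * q = s * t := by
    intro r hr
    induction hr using Subsemigroup.closure_induction with
    | mem r hr =>
      rcases hr with rfl
      exact fun q => ⟨q, rfl⟩
    | mul p q hp hq ihp ihq =>
      intro q'
      rw [mul_assoc]
      exact ihp _
  rw [← hee]
  exact key e he e

theorem commute_of_mem_closure {A : Set S} (h : ∀ a ∈ A, ∀ b ∈ A, a * b = b * a) {a b : S}
    (ha : a ∈ Subsemigroup.closure A) (hb : b ∈ Subsemigroup.closure A) : a * b = b * a := by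
  have key : ∀ a ∈ A, ∀ b ∈ Subsemigroup.closure A, a * b = b * a := by
    intro a ha b hb
    induction hb using Subsemigroup.closure_induction with
    | mem b hb => exact h a ha b hb
    | mul p q hp hq ihp ihq => rw [← mul_assoc, ihp, mul_assoc, ihq, mul_assoc]
  induction ha using Subsemigroup.closure_induction with
  | mem a ha => exact key a ha b hb
  | mul p q hp hq ihp ihq => rw [mul_assoc, ihq, ← mul_assoc, ihp, mul_assoc]

theorem sandwich_comm {A : Subsemigroup S} (hA : ∀ a ∈ A, ∀ b ∈ A, a * b = b * a) {a b : S}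
    (ha : a ∈ A) (hb : b ∈ A) {c : WithOne S} (hc : ∀ s : S, c = (s : WithOne S) → s ∈ A) :
    sandwich a c b = sandwich b c a := by
  induction c using WithOne.recOneCoe with
  | one => exact hA a ha b hb
  | coe c =>
    rw [sandwich_coe, sandwich_coe, hA a ha c (hc c rfl), mul_assoc, hA a ha b hb, ← mul_assoc,
      hA c (hc c rfl) b hb]

end Green

/-! ### Pairs that do not survive -/

section NotSurvives

variable {S : Type*} [Semigroup S] {L T : Set S} {x y a b : S}

theorem not_survives_of_commute (hS : HasLocalSurvivors S) {e h : S} (heh : h * e = e * h) :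
    ¬ Survives ∅ Set.univ h e := by
  intro hs
  obtain ⟨a, ha, b, hb, hab⟩ := hS ∅ (by simp) h e hs
  obtain ⟨c, hc, hs⟩ := hab.step
  refine hs.ne (sandwich_comm (fun p hp q hq => commute_of_mem_closure ?_ hp hq) ha hb hc)
  rintro _ (rfl | rfl) _ (rfl | rfl)
  exacts [rfl, heh, heh.symm, rfl]

/-- Left translation by `x` carries Mal'cev words to Mal'cev words with parameters
multiplied by `x`. -/
theorem Survives.of_mul_left {h e : S} (hs : Survives ∅ Set.univ (x * h) (x * e)) :
    Survives ∅ Set.univ h e := by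
  refine Survives.of_invariant (fun p q => Survives ∅ Set.univ (x * p) (x * q)) ?_ hs
  intro p q hpq
  obtain ⟨c, -, hc⟩ := hpq.step
  refine ⟨fun h => hpq.ne (by rw [h]), id, id, ?_⟩
  induction c using WithOne.recOneCoe with
  | one =>
    refine ⟨(x : WithOne S), fun _ _ => trivial, ?_⟩
    simpa only [sandwich_coe, sandwich_one, mul_assoc] using hc
  | coe c =>
    refine ⟨((c * x : S) : WithOne S), fun _ _ => trivial, ?_⟩
    simpa only [sandwich_coe, mul_assoc] using hc

/-- Two `ℋ`-related elements have the form `a e`, `a h` with commuting `e` and `h`, and the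
pair `(h, e)` does not survive. In particular all subgroups are nilpotent. -/
theorem not_survives_of_rRel_lRel [Finite S] (hS : HasLocalSurvivors S) (hR : RRel a b)
    (hL : LRel a b) : ¬ Survives ∅ Set.univ a b := by
  intro hs
  obtain ⟨⟨s, hs'⟩, t, ht⟩ := hR
  obtain ⟨⟨v, hv⟩, -⟩ := hL
  obtain ⟨e, he, hee, hae⟩ := exists_idempotent_mul_eq (x := a) (u := 1) (s := s * t)
    (by rw [one_mul, ← WithOne.coe_mul, ← mul_assoc, hs', ht])
  have hbe : b * e = b := by rw [← hv, mul_assoc, hae]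
  have h1 : a * (e * s * e) = b := by
    rw [← mul_assoc, ← mul_assoc, hae, hs', hbe]
  apply not_survives_of_commute hS (h := e * s * e) (e := e)
    (by simp only [mul_assoc, hee]; simp only [← mul_assoc, hee])
  apply Survives.of_mul_left (x := a)
  rw [h1, hae]
  exact hs.symm

/-- If `x x` and `y x` lie in the ideal `L`, then modulo `L` the semigroup `⟨x, y⟩` consists of
elements `yᵏ` and `x yᵏ`, and is nilpotent. -/
theorem not_survives_closure_of_mul_mem (hL : ∀ s, ∀ t ∈ L, s * t ∈ L ∧ t * s ∈ L)
    (hxx : x * x ∈ L) (hyx : y * x ∈ L)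
    (ha : a ∈ Subsemigroup.closure ({x, y} : Set S))
    (hb : b ∈ Subsemigroup.closure ({x, y} : Set S)) :
    ¬ Survives L (Subsemigroup.closure ({x, y} : Set S) : Set S) a b := by
  intro hs
  have h1 : ∀ w ∈ Subsemigroup.closure ({x, y} : Set S), w * x ∈ L := by
    intro w hw
    induction hw using Subsemigroup.closure_induction with
    | mem w hw => rcases hw with rfl | rfl <;> assumption
    | mul p q hp hq ihp ihq => rw [mul_assoc]; exact (hL p _ ihq).1
  have h2 : ∀ w ∈ Subsemigroup.closure ({x, y} : Set S),
      w ∈ Subsemigroup.closure ({y} : Set S) ∨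
        ∀ w' ∈ Subsemigroup.closure ({x, y} : Set S), w' * w ∈ L := by
    intro w hw
    induction hw using Subsemigroup.closure_induction with
    | mem w hw =>
      rcases hw with rfl | rfl
      · exact Or.inr h1
      · exact Or.inl (Subsemigroup.subset_closure rfl)
    | mul p q hp hq ihp ihq =>
      rcases ihp with ihp | ihp
      · rcases ihq with ihq | ihq
        · exact Or.inl (Subsemigroup.mul_mem _ ihp ihq)
        · exact Or.inr fun w' hw' => by
            rw [← mul_assoc]; exact ihq _ (Subsemigroup.mul_mem _ hw' hp)
      · exact Or.inr fun w' hw' => by rw [← mul_assoc]; exact (hL q _ (ihp w' hw')).2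
  obtain ⟨c, hc, hs⟩ := hs.step
  have h3 : ∀ p ∈ Subsemigroup.closure ({x, y} : Set S),
      ∀ q ∈ Subsemigroup.closure ({x, y} : Set S), sandwich p c q ∉ L →
        q ∈ Subsemigroup.closure ({y} : Set S) ∧
          ∀ s : S, c = (s : WithOne S) → s ∈ Subsemigroup.closure ({y} : Set S) := by
    intro p hp q hq hn
    induction c using WithOne.recOneCoe with
    | one =>
      refine ⟨(h2 q hq).resolve_right fun h => hn (h p hp), fun s hs => ?_⟩
      exact absurd hs WithOne.one_ne_coe
    | coe c =>
      have hcm := hc c rfl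
      refine ⟨(h2 q hq).resolve_right fun h => hn (h _ (Subsemigroup.mul_mem _ hp hcm)), ?_⟩
      intro s hs
      rw [WithOne.coe_inj] at hs
      rw [← hs]
      exact (h2 c hcm).resolve_right fun h => hn (hL q _ (h p hp)).2
  obtain ⟨hb', hc'⟩ := h3 a ha b hb hs.notMem_left
  obtain ⟨ha', -⟩ := h3 b hb a ha hs.notMem_right
  refine hs.ne (sandwich_comm (fun p hp q hq => commute_of_mem_closure ?_ hp hq) ha' hb' hc')
  rintro _ rfl _ rfl
  rfl

end NotSurvives

/-! ### Regular blocks -/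

section Block

variable {S : Type*} [Semigroup S] {C L T : Set S} {x y z s t a b : S}

/-- A regular `𝒥`-class `C`, together with an ideal `L` disjoint from `C` such that `C ∪ L` is
an ideal. As `C` is regular, `𝒥`-equivalence can be expressed by factors in `S`. -/
structure IsRegularBlock (C L : Set S) : Prop where
  lower : ∀ s, ∀ t ∈ L, s * t ∈ L ∧ t * s ∈ L
  upper : ∀ s, ∀ x ∈ C, (s * x ∈ C ∨ s * x ∈ L) ∧ (x * s ∈ C ∨ x * s ∈ L)
  disj : ∀ x ∈ C, x ∉ L
  jclass : ∀ x ∈ C, ∀ y ∈ C, ∃ u v : S, y = u * x * v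
  idem : ∃ e ∈ C, e * e = e

namespace IsRegularBlock

theorem op (hC : IsRegularBlock C L) :
    IsRegularBlock (MulOpposite.unop ⁻¹' C) (MulOpposite.unop ⁻¹' L) where
  lower s t ht := (hC.lower _ _ ht).symm
  upper s x hx := (hC.upper _ _ hx).symm
  disj x hx := hC.disj _ hx
  jclass x hx y hy := by
    obtain ⟨u, v, h⟩ := hC.jclass _ hx _ hy
    refine ⟨MulOpposite.op v, MulOpposite.op u, MulOpposite.unop_injective ?_⟩
    rw [h, mul_assoc]
    rfl
  idem := by
    obtain ⟨e, he, hee⟩ := hC.idem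
    exact ⟨MulOpposite.op e, he, congrArg MulOpposite.op hee⟩

theorem mul_mem_of_right (hC : IsRegularBlock C L) (hx : x ∈ C) (h : s * x ∉ L) : s * x ∈ C :=
  (hC.upper s x hx).1.resolve_right h

theorem mul_mem_of_left (hC : IsRegularBlock C L) (hx : x ∈ C) (h : x * s ∉ L) : x * s ∈ C :=
  (hC.upper s x hx).2.resolve_right h

theorem notMem_of_mul_left (hC : IsRegularBlock C L) (h : s * x ∈ C) : x ∉ L :=
  fun hx => hC.disj _ h (hC.lower s x hx).1

theorem notMem_of_mul_right (hC : IsRegularBlock C L) (h : x * s ∈ C) : x ∉ L :=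
  fun hx => hC.disj _ h (hC.lower s x hx).2

/-- Stability of finite semigroups: a right multiple of `x` in the `𝒥`-class of `x` is
`ℛ`-related to `x`. -/
theorem rRel_mul [Finite S] (hC : IsRegularBlock C L) (hx : x ∈ C) (hxs : x * s ∈ C) :
    RRel x (x * s) := by
  obtain ⟨u, v, h⟩ := hC.jclass _ hxs _ hx
  obtain ⟨e, he, hee, hxe⟩ := exists_idempotent_mul_eq (x := x) (u := (u : WithOne S))
    (s := s * v) (by rw [← WithOne.coe_mul, ← WithOne.coe_mul]; congr 1; simpa [mul_assoc] using h)
  obtain ⟨t, rfl⟩ := exists_eq_mul_of_mem_closure he hee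
  exact ⟨⟨s, rfl⟩, v * t, by rw [mul_assoc, ← mul_assoc s, hxe]⟩

theorem lRel_mul [Finite S] (hC : IsRegularBlock C L) (hx : x ∈ C) (hsx : s * x ∈ C) :
    LRel x (s * x) := by
  have : Finite Sᵐᵒᵖ := Finite.of_equiv S MulOpposite.opEquiv
  exact RRel.unop (hC.op.rRel_mul (x := MulOpposite.op x) (s := MulOpposite.op s) hx hsx)

theorem rRel_refl [Finite S] (hC : IsRegularBlock C L) (hx : x ∈ C) : RRel x x := by
  obtain ⟨u, v, h⟩ := hC.jclass _ hx _ hx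
  obtain ⟨e, -, -, hxe⟩ := exists_idempotent_mul_eq (x := x) (u := (u : WithOne S))
    (s := v) (by rw [← WithOne.coe_mul, ← WithOne.coe_mul]; exact congrArg _ h)
  exact ⟨⟨e, hxe⟩, e, hxe⟩

theorem lRel_refl [Finite S] (hC : IsRegularBlock C L) (hx : x ∈ C) : LRel x x := by
  have : Finite Sᵐᵒᵖ := Finite.of_equiv S MulOpposite.opEquiv
  exact RRel.unop (hC.op.rRel_refl (x := MulOpposite.op x) hx)

theorem exists_mul_mul_notMem (hC : IsRegularBlock C L) (hx : x ∈ C) (hy : y ∈ C) :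
    ∃ d, x * d * y ∉ L := by
  obtain ⟨e, he, hee⟩ := hC.idem
  obtain ⟨α, β, h1⟩ := hC.jclass x hx e he
  obtain ⟨γ, δ, h2⟩ := hC.jclass y hy e he
  refine ⟨β * γ, fun h => hC.disj e he ?_⟩
  have h3 : e = α * (x * (β * γ) * y * δ) := by
    calc e = e * e := hee.symm
      _ = (α * x * β) * (γ * y * δ) := by rw [← h1, ← h2]
      _ = _ := by simp only [mul_assoc]
  rw [h3]
  exact (hC.lower _ _ (hC.lower _ _ h).2).1

theorem exists_mul_mem (hC : IsRegularBlock C L) (hx : x ∈ C) : ∃ z ∈ C, z * x ∈ C := by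
  obtain ⟨e, he, hee⟩ := hC.idem
  obtain ⟨d, hd⟩ := hC.exists_mul_mul_notMem he hx
  exact ⟨e * d, hC.mul_mem_of_left he fun h => hd (hC.lower _ _ h).2,
    hC.mul_mem_of_right hx hd⟩

/-- Suppose that `a`, `b` are not `ℛ`-related and that `z a`, `z b` are both in `C`. Then
`z' a ∈ C` for all `z' ∈ C`. Indeed let `x'`, `y'` be `ℛ`-related to `a` and `b`, and both
`ℒ`-related to `z'`. The pair `(x', y')` survives, by the parameter `d z` with `z' d z ∈ C`;
but if `z' a ∈ L`, then `x' x'` and `y' x'` lie in `L`, and `⟨x', y'⟩` is nilpotent modulo `L`. -/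
theorem mul_mem_of_linked [Finite S] (hS : HasLocalSurvivors S) (hC : IsRegularBlock C L)
    (ha : a ∈ C) (hb : b ∈ C) (hz : z ∈ C) (hza : z * a ∈ C) (hzb : z * b ∈ C)
    (hab : ¬ RRel a b) {z' : S} (hz' : z' ∈ C) : z' * a ∈ C := by
  refine hC.mul_mem_of_right ha fun hn => ?_
  obtain ⟨u, v, hu⟩ := hC.jclass a ha z' hz'
  obtain ⟨u', v', hu'⟩ := hC.jclass b hb z' hz'
  have hav : a * v ∈ C := hC.mul_mem_of_left ha
    (hC.notMem_of_mul_left (s := u) (by rw [← mul_assoc, ← hu]; exact hz'))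
  have hbv : b * v' ∈ C := hC.mul_mem_of_left hb
    (hC.notMem_of_mul_left (s := u') (by rw [← mul_assoc, ← hu']; exact hz'))
  have hRa := hC.rRel_mul ha hav
  have hRb := hC.rRel_mul hb hbv
  have hLa : LRel z' (a * v) := by
    have := hC.lRel_mul hav (s := u) (by rw [← mul_assoc, ← hu]; exact hz')
    rw [← mul_assoc, ← hu] at this
    exact this.symm
  have hLb : LRel z' (b * v') := by
    have := hC.lRel_mul hbv (s := u') (by rw [← mul_assoc, ← hu']; exact hz')
    rw [← mul_assoc, ← hu'] at this
    exact this.symm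
  obtain ⟨d, hd⟩ := hC.exists_mul_mul_notMem hz' hz
  -- `q` can be cancelled whenever it is `ℛ`-related to `g` with `z g ∈ C`
  have hcancel : ∀ p q g, g ∈ C → z * g ∈ C → RRel g q → LRel z' p → p * (d * z) * q ∉ L := by
    intro p q g hg hzg hR hL hmem
    obtain ⟨-, τ, hτ⟩ := hC.rRel_mul hz hzg
    obtain ⟨-, τ', hτ'⟩ := hR
    obtain ⟨-, r, hr⟩ := hL
    apply hd
    have h1 : z' * d * z = r * (p * (d * z) * q * (τ' * τ)) := by
      calc z' * d * z = r * p * d * (z * (q * τ') * τ) := by rw [hr, hτ', hτ]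
        _ = _ := by simp only [mul_assoc]
    rw [h1]
    exact (hC.lower _ _ (hC.lower _ _ hmem).2).1
  have hsurv : Survives L Set.univ (a * v) (b * v') := by
    refine Survives.of_invariant (fun p q => p ∈ C ∧ q ∈ C ∧ RRel a p ∧ RRel b q ∧
      LRel z' p ∧ LRel z' q) ?_ ⟨hav, hbv, hRa, hRb, hLa, hLb⟩
    rintro p q ⟨hp, hq, hap, hbq, hLp, hLq⟩
    refine ⟨fun h => hab (hap.trans (h ▸ hbq.symm)), hC.disj p hp, hC.disj q hq,
      ((d * z : S) : WithOne S), fun _ _ => trivial, ?_⟩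
    have h1 : p * (d * z) * q ∈ C := hC.mul_mem_of_right hq (hcancel p q b hb hzb hbq hLp)
    have h2 : q * (d * z) * p ∈ C := hC.mul_mem_of_right hp (hcancel q p a ha hza hap hLq)
    refine ⟨h1, h2, hap.trans ?_, hbq.trans ?_, hLq.trans ?_, hLp.trans ?_⟩
    · rw [mul_assoc] at h1
      rw [sandwich_coe, mul_assoc]
      exact hC.rRel_mul hp h1
    · rw [mul_assoc] at h2
      rw [sandwich_coe, mul_assoc]
      exact hC.rRel_mul hq h2
    · exact hC.lRel_mul hq h1
    · exact hC.lRel_mul hp h2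
  obtain ⟨p, hp, q, hq, hpq⟩ := hS L hC.lower _ _ hsurv
  obtain ⟨-, r, hr⟩ := hLa.symm
  obtain ⟨-, r', hr'⟩ := hLb.symm
  have hmem : ∀ r, r * z' * (a * v) ∈ L := by
    intro r
    rw [mul_assoc, ← mul_assoc z']
    exact (hC.lower _ _ (hC.lower _ _ hn).2).1
  refine not_survives_closure_of_mul_mem hC.lower ?_ ?_ hp hq hpq
  · have := hmem r
    rwa [hr] at this
  · have := hmem r'
    rwa [hr'] at this

theorem mul_mem_of_linked' [Finite S] (hS : HasLocalSurvivors S) (hC : IsRegularBlock C L)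
    (ha : a ∈ C) (hb : b ∈ C) (hz : z ∈ C) (haz : a * z ∈ C) (hbz : b * z ∈ C)
    (hab : ¬ LRel a b) {z' : S} (hz' : z' ∈ C) : a * z' ∈ C := by
  have : Finite Sᵐᵒᵖ := Finite.of_equiv S MulOpposite.opEquiv
  exact hC.op.mul_mem_of_linked hS.op (a := MulOpposite.op a) (b := MulOpposite.op b)
    (z := MulOpposite.op z) (z' := MulOpposite.op z') ha hb hz haz hbz
    (fun h => hab h.unop) hz'

theorem mul_mem_of_survives_of_not_rRel [Finite S] (hS : HasLocalSurvivors S)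
    (hC : IsRegularBlock C L) (hT : T ⊆ C ∪ L) (ha : a ∈ C) (hb : b ∈ C)
    (hs : Survives L T a b) (hab : ¬ RRel a b) (hx : x ∈ C) (hy : y ∈ C) : x * y ∈ C := by
  -- the first two parameters, or `b` if they are trivial, provide an element linking `a` and `b`
  have hlink : ∃ z ∈ C, z * a ∈ C ∧ z * b ∈ C := by
    have hcC : ∀ p q c : S, c ∈ T → p * c * q ∉ L → c ∈ C := fun p q c hc h =>
      (hT hc).resolve_right fun hcL => h (hC.lower _ _ (hC.lower _ _ hcL).1).2
    obtain ⟨c, hc, h1⟩ := hs.step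
    induction c using WithOne.recOneCoe with
    | coe c =>
      have h2 : a * c * b ∉ L := h1.notMem_left
      have h3 : b * c * a ∉ L := h1.notMem_right
      rw [mul_assoc] at h3
      have h4 := h2
      rw [mul_assoc] at h4
      exact ⟨c, hcC _ _ c (hc c rfl) h2,
        hC.mul_mem_of_right ha fun h => h3 (hC.lower _ _ h).1,
        hC.mul_mem_of_right hb fun h => h4 (hC.lower _ _ h).1⟩
    | one =>
      have h2 : b * a ∉ L := h1.notMem_right
      obtain ⟨c, hc, h3⟩ := h1.step
      induction c using WithOne.recOneCoe with
      | coe c =>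
        have h4 : (a * b) * c * (b * a) ∉ L := h3.notMem_left
        have h5 : (b * a) * c * (a * b) ∉ L := h3.notMem_right
        refine ⟨c, hcC _ _ c (hc c rfl) h4, hC.mul_mem_of_right ha fun h => h5 ?_,
          hC.mul_mem_of_right hb fun h => h4 ?_⟩
        · rw [mul_assoc, ← mul_assoc c]
          exact (hC.lower _ _ (hC.lower _ _ h).2).1
        · rw [mul_assoc, ← mul_assoc c]
          exact (hC.lower _ _ (hC.lower _ _ h).2).1
      | one =>
        have h4 : (a * b) * (b * a) ∉ L := h3.notMem_left
        refine ⟨b, hb, hC.mul_mem_of_right ha h2, hC.mul_mem_of_right hb fun h => h4 ?_⟩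
        rw [mul_assoc, ← mul_assoc b]
        exact (hC.lower _ _ (hC.lower _ _ h).2).1
  obtain ⟨z, hz, hza, hzb⟩ := hlink
  have h1 : ∀ z' ∈ C, z' * a ∈ C := fun z' hz' =>
    hC.mul_mem_of_linked hS ha hb hz hza hzb hab hz'
  by_cases hL : ∃ w ∈ C, ¬ LRel x w
  · obtain ⟨w, hw, hxw⟩ := hL
    exact hC.mul_mem_of_linked' hS hx hw ha (h1 x hx) (h1 w hw) hxw hy
  · push Not at hL
    obtain ⟨w, hw, hwy⟩ := hC.exists_mul_mem hy
    obtain ⟨-, t, ht⟩ := (hL w hw).symm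
    obtain ⟨r, hr⟩ := (hL w hw).1
    refine hC.mul_mem_of_right hy fun h => hC.disj _ hwy ?_
    rw [← hr, mul_assoc]
    exact (hC.lower _ _ h).1

/-- A regular principal factor that is not nilpotent has no zero divisors. -/
theorem mul_mem_of_survives [Finite S] (hS : HasLocalSurvivors S)
    (hC : IsRegularBlock C L) (hT : T ⊆ C ∪ L) (ha : a ∈ C) (hb : b ∈ C)
    (hs : Survives L T a b) (hx : x ∈ C) (hy : y ∈ C) : x * y ∈ C := by
  have : Finite Sᵐᵒᵖ := Finite.of_equiv S MulOpposite.opEquiv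
  by_cases hR : RRel a b
  · have hL : ¬ LRel a b := fun hL => not_survives_of_rRel_lRel hS hR hL
      (hs.mono (Set.empty_subset _) (Set.subset_univ _))
    exact hC.op.mul_mem_of_survives_of_not_rRel hS.op (T := MulOpposite.unop ⁻¹' T)
      (fun s hs => hT hs) (a := MulOpposite.op a) (b := MulOpposite.op b) ha hb hs.op
      (fun h => hL h.unop) (x := MulOpposite.op y) (y := MulOpposite.op x) hy hx
  · exact hC.mul_mem_of_survives_of_not_rRel hS hT ha hb hs hR hx hy

end IsRegularBlock

/-- A `𝒥`-class that contains a product of two of its elements is regular. -/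
theorem isRegularBlock_of_mul_mem [Finite S]
    (lower : ∀ s, ∀ t ∈ L, s * t ∈ L ∧ t * s ∈ L)
    (upper : ∀ s, ∀ x ∈ C, (s * x ∈ C ∨ s * x ∈ L) ∧ (x * s ∈ C ∨ x * s ∈ L))
    (disj : ∀ x ∈ C, x ∉ L)
    (jclass : ∀ x ∈ C, ∀ y ∈ C, ∃ u v : WithOne S, (y : WithOne S) = u * x * v)
    {p q : S} (hp : p ∈ C) (hq : q ∈ C) (hpq : p * q ∈ C) : IsRegularBlock C L := by
  have hidem : ∃ e ∈ C, e * e = e := by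
    obtain ⟨u, v, h⟩ := jclass _ hpq _ hp
    have : ∃ r : S, (r : WithOne S) = q * v ∧ (r ∈ C ∨ r ∈ L) := by
      induction v using WithOne.recOneCoe with
      | one => exact ⟨q, (mul_one _).symm, Or.inl hq⟩
      | coe v => exact ⟨q * v, WithOne.coe_mul _ _, (upper v q hq).2⟩
    obtain ⟨r, hr, hrC⟩ := this
    obtain ⟨e, he, hee, hpe⟩ := exists_idempotent_mul_eq (x := p) (u := u) (s := r) (by
      rw [hr, ← mul_assoc, mul_assoc u, ← WithOne.coe_mul]; exact h)
    obtain ⟨t, rfl⟩ := exists_eq_mul_of_mem_closure he hee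
    have hn : r * t ∉ L := fun h => disj p hp (hpe ▸ (lower p _ h).1)
    refine ⟨r * t, ?_, hee⟩
    rcases hrC with hrC | hrL
    · exact (upper t r hrC).2.resolve_right hn
    · exact absurd (lower t r hrL).2 hn
  refine ⟨lower, upper, disj, fun x hx y hy => ?_, hidem⟩
  obtain ⟨e, he, hee⟩ := hidem
  obtain ⟨α, β, h1⟩ := jclass x hx e he
  obtain ⟨u, v, h2⟩ := jclass e he y hy
  -- inserting copies of `e` turns all factors into elements of `S`
  have hl : ∀ (c : S) (w : WithOne S), ∃ d : S, (d : WithOne S) = w * c := by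
    intro c w
    induction w using WithOne.recOneCoe with
    | one => exact ⟨c, (one_mul _).symm⟩
    | coe w => exact ⟨w * c, WithOne.coe_mul _ _⟩
  have hr : ∀ (c : S) (w : WithOne S), ∃ d : S, (d : WithOne S) = c * w := by
    intro c w
    induction w using WithOne.recOneCoe with
    | one => exact ⟨c, (mul_one _).symm⟩
    | coe w => exact ⟨c * w, WithOne.coe_mul _ _⟩
  obtain ⟨a, ha⟩ := hr e α
  obtain ⟨b, hb⟩ := hl e β
  obtain ⟨a', ha'⟩ := hl a u
  obtain ⟨b', hb'⟩ := hr b v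
  refine ⟨a', b', WithOne.coe_injective ?_⟩
  have hee' : (e : WithOne S) = e * e * e := by
    rw [← WithOne.coe_mul, hee, ← WithOne.coe_mul, hee]
  rw [WithOne.coe_mul, WithOne.coe_mul, ha', hb', ha, hb, h2]
  calc u * (e : WithOne S) * v = u * (e * e * e) * v := by rw [← hee']
    _ = u * (e * (α * x * β) * e) * v := by rw [← h1]
    _ = _ := by simp only [mul_assoc]

end Block

/-! ### Completely simple blocks and the elements acting on them -/

section SimpleBlock

variable {S : Type*} [Semigroup S] {C L T : Set S} {x y z s t a b : S}

/-- A completely simple `𝒥`-class that is not a group: a regular block without zero divisors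
which contains two elements that are not `ℋ`-related. -/
structure IsSimpleBlock (C L : Set S) : Prop extends IsRegularBlock C L where
  mul_mem : ∀ x ∈ C, ∀ y ∈ C, x * y ∈ C
  exists_not_related : ∃ x ∈ C, ∃ y ∈ C, ¬ (RRel x y ∧ LRel x y)

/-- The elements acting on `C` by multiplication, without zero products. -/
def actingSet (C : Set S) : Set S := {s | ∀ x ∈ C, s * x ∈ C ∧ x * s ∈ C}

/-- The elements `s` and `t` have the same action on the `ℛ`-classes and on the `ℒ`-classes
of `C`. For a pseudo-nilpotent semigroup this means that the pseudo-nilpotent homomorphism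
takes the same value at `s` and `t`. -/
def SameAction (C : Set S) (s t : S) : Prop :=
  ∀ k ∈ C, RRel (s * k) (t * k) ∧ LRel (k * s) (k * t)

theorem SameAction.symm (h : SameAction C s t) : SameAction C t s :=
  fun k hk => ⟨(h k hk).1.symm, (h k hk).2.symm⟩

theorem SameAction.trans {u : S} (h : SameAction C s t) (h' : SameAction C t u) :
    SameAction C s u :=
  fun k hk => ⟨(h k hk).1.trans (h' k hk).1, (h k hk).2.trans (h' k hk).2⟩

theorem mul_mem_actingSet (hs : s ∈ actingSet C) (ht : t ∈ actingSet C) :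
    s * t ∈ actingSet C := fun x hx =>
  ⟨by rw [mul_assoc]; exact (hs _ (ht x hx).1).1,
    by rw [← mul_assoc]; exact (ht _ (hs x hx).2).2⟩

theorem mem_actingSet_of_mem_closure {A : Set S} (hA : A ⊆ actingSet C)
    (hs : s ∈ Subsemigroup.closure A) : s ∈ actingSet C := by
  induction hs using Subsemigroup.closure_induction with
  | mem s hs => exact hA hs
  | mul p q hp hq ihp ihq => exact mul_mem_actingSet ihp ihq

namespace IsSimpleBlock

theorem subset_actingSet (hC : IsSimpleBlock C L) : C ⊆ actingSet C :=
  fun s hs x hx => ⟨hC.mul_mem s hs x hx, hC.mul_mem x hx s hs⟩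

theorem nonempty (hC : IsSimpleBlock C L) : ∃ x, x ∈ C := by
  obtain ⟨x, hx, -⟩ := hC.exists_not_related
  exact ⟨x, hx⟩

theorem notMem_of_mem_actingSet (hC : IsSimpleBlock C L) (hs : s ∈ actingSet C) : s ∉ L := by
  obtain ⟨x, hx⟩ := hC.nonempty
  exact hC.notMem_of_mul_right (hs x hx).1

theorem mem_actingSet_of_mul_left (hC : IsSimpleBlock C L) (hx : x ∈ C) (h : s * x ∉ L) :
    s ∈ actingSet C := by
  have h1 : s * x ∈ C := hC.mul_mem_of_right hx h
  have h2 : ∀ y ∈ C, y * s ∈ C := fun y hy =>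
    hC.mul_mem_of_left hy (hC.notMem_of_mul_right (s := x)
      (by rw [mul_assoc]; exact hC.mul_mem y hy _ h1))
  exact fun y hy => ⟨hC.mul_mem_of_right hy (hC.notMem_of_mul_left (s := x)
    (by rw [← mul_assoc]; exact hC.mul_mem _ (h2 x hx) y hy)), h2 y hy⟩

theorem mem_actingSet_of_mul_right (hC : IsSimpleBlock C L) (hx : x ∈ C) (h : x * s ∉ L) :
    s ∈ actingSet C := by
  have h1 : x * s ∈ C := hC.mul_mem_of_left hx h
  exact hC.mem_actingSet_of_mul_left hx (hC.notMem_of_mul_left (s := x)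
    (by rw [← mul_assoc]; exact hC.mul_mem _ h1 x hx))

theorem of_mul_mem_actingSet (hC : IsSimpleBlock C L) (h : s * t ∈ actingSet C) :
    s ∈ actingSet C ∧ t ∈ actingSet C := by
  obtain ⟨x, hx⟩ := hC.nonempty
  obtain ⟨h1, h2⟩ := h x hx
  rw [mul_assoc] at h1
  rw [← mul_assoc] at h2
  exact ⟨hC.mem_actingSet_of_mul_right hx (hC.notMem_of_mul_right h2),
    hC.mem_actingSet_of_mul_left hx (hC.notMem_of_mul_left h1)⟩

variable [Finite S]

theorem sameAction_refl (hC : IsSimpleBlock C L) (hs : s ∈ actingSet C) : SameAction C s s :=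
  fun k hk => ⟨hC.rRel_refl (hs k hk).1, hC.lRel_refl (hs k hk).2⟩

theorem sameAction_iff (hC : IsSimpleBlock C L) (hx : x ∈ C) (hy : y ∈ C) :
    SameAction C x y ↔ RRel x y ∧ LRel x y := by
  have hR : ∀ x ∈ C, ∀ k ∈ C, RRel x (x * k) := fun x hx k hk =>
    hC.rRel_mul hx (hC.mul_mem x hx k hk)
  have hL : ∀ x ∈ C, ∀ k ∈ C, LRel x (k * x) := fun x hx k hk =>
    hC.lRel_mul hx (hC.mul_mem k hk x hx)
  constructor
  · intro h
    obtain ⟨h1, h2⟩ := h x hx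
    exact ⟨(hR x hx x hx).trans (h1.trans (hR y hy x hx).symm),
      (hL x hx x hx).trans (h2.trans (hL y hy x hx).symm)⟩
  · rintro ⟨h1, h2⟩ k hk
    exact ⟨(hR x hx k hk).symm.trans (h1.trans (hR y hy k hk)),
      (hL x hx k hk).symm.trans (h2.trans (hL y hy k hk))⟩

/-- If `s` fixes the `ℋ`-class of `x`, then `⟨s, x⟩` consists of powers of `s` and of elements
of this `ℋ`-class, so it is nilpotent. -/
theorem not_survives_closure_of_fix (hS : HasLocalSurvivors S) (hC : IsSimpleBlock C L)
    (hs : s ∈ actingSet C) (hx : x ∈ C) (hR : RRel (s * x) x) (hL : LRel (x * s) x)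
    (ha : a ∈ Subsemigroup.closure ({s, x} : Set S))
    (hb : b ∈ Subsemigroup.closure ({s, x} : Set S)) :
    ¬ Survives ∅ (Subsemigroup.closure ({s, x} : Set S) : Set S) a b := by
  let H : Set S := {h | h ∈ C ∧ RRel h x ∧ LRel h x}
  have hsH : ∀ h ∈ H, s * h ∈ H := fun h ⟨h1, h2, h3⟩ =>
    ⟨(hs h h1).1, (h2.mul_left s).trans hR, (hC.lRel_mul h1 (hs h h1).1).symm.trans h3⟩
  have hHs : ∀ h ∈ H, h * s ∈ H := fun h ⟨h1, h2, h3⟩ =>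
    ⟨(hs h h1).2, (hC.rRel_mul h1 (hs h h1).2).symm.trans h2, (h3.mul_right s).trans hL⟩
  have hHH : ∀ g ∈ H, ∀ h ∈ H, g * h ∈ H := fun g ⟨g1, g2, g3⟩ h ⟨h1, h2, h3⟩ =>
    have hm := hC.mul_mem g g1 h h1
    ⟨hm, (hC.rRel_mul g1 hm).symm.trans g2, (hC.lRel_mul h1 hm).symm.trans h3⟩
  have hpH : ∀ p ∈ Subsemigroup.closure ({s} : Set S), ∀ h ∈ H, p * h ∈ H ∧ h * p ∈ H := by
    intro p hp
    induction hp using Subsemigroup.closure_induction with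
    | mem p hp =>
      rcases hp with rfl
      exact fun h hh => ⟨hsH h hh, hHs h hh⟩
    | mul p q hp hq ihp ihq =>
      intro h hh
      rw [mul_assoc, ← mul_assoc h]
      exact ⟨(ihp _ (ihq h hh).1).1, (ihq _ (ihp h hh).2).2⟩
  have hcl : ∀ p ∈ Subsemigroup.closure ({s, x} : Set S),
      p ∈ Subsemigroup.closure ({s} : Set S) ∨ p ∈ H := by
    intro p hp
    induction hp using Subsemigroup.closure_induction with
    | mem p hp =>
      rcases hp with rfl | rfl
      · exact Or.inl (Subsemigroup.subset_closure rfl)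
      · exact Or.inr ⟨hx, hC.rRel_refl hx, hC.lRel_refl hx⟩
    | mul p q hp hq ihp ihq =>
      rcases ihp with ihp | ihp <;> rcases ihq with ihq | ihq
      · exact Or.inl (Subsemigroup.mul_mem _ ihp ihq)
      · exact Or.inr (hpH p ihp q ihq).1
      · exact Or.inr (hpH q ihq p ihp).2
      · exact Or.inr (hHH p ihp q ihq)
  have hHcl : ∀ h ∈ H, ∀ p ∈ Subsemigroup.closure ({s, x} : Set S), p * h ∈ H ∧ h * p ∈ H := by
    intro h hh p hp
    rcases hcl p hp with h' | h'
    · exact hpH p h' h hh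
    · exact ⟨hHH p h' h hh, hHH h hh p h'⟩
  intro hab
  obtain ⟨c, hc, hsv⟩ := hab.step
  -- a pair of elements of `H` does not survive
  have hfin : ∀ p ∈ H, ∀ q ∈ H,
      ¬ Survives ∅ (Subsemigroup.closure ({s, x} : Set S) : Set S) p q :=
    fun p hp q hq h => not_survives_of_rRel_lRel hS (hp.2.1.trans hq.2.1.symm)
      (hp.2.2.trans hq.2.2.symm) (h.mono subset_rfl (Set.subset_univ _))
  have hsand : ∀ p ∈ Subsemigroup.closure ({s, x} : Set S),
      ∀ q ∈ Subsemigroup.closure ({s, x} : Set S), (p ∈ H ∨ q ∈ H ∨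
        ∃ c' : S, c = (c' : WithOne S) ∧ c' ∈ H) → sandwich p c q ∈ H := by
    intro p hp q hq h
    induction c using WithOne.recOneCoe with
    | one =>
      rcases h with h | h | ⟨c', h, -⟩
      · exact (hHcl p h q hq).2
      · exact (hHcl q h p hp).1
      · exact absurd h WithOne.one_ne_coe
    | coe c =>
      have hcm := hc c rfl
      rcases h with h | h | ⟨c', h, h'⟩
      · exact (hHcl _ (hHcl p h c hcm).2 q hq).2
      · exact (hHcl q h _ (Subsemigroup.mul_mem _ hp hcm)).1
      · rw [WithOne.coe_inj] at h
        rw [← h] at h'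
        exact (hHcl _ (hHcl c h' p hp).1 q hq).2
  by_cases hH : a ∈ H ∨ b ∈ H ∨ ∃ c' : S, c = (c' : WithOne S) ∧ c' ∈ H
  · exact hfin _ (hsand a ha b hb hH) _ (hsand b hb a ha (by tauto)) hsv
  · rw [not_or, not_or] at hH
    refine hsv.ne (sandwich_comm (A := Subsemigroup.closure ({s} : Set S))
      (fun p hp q hq => commute_of_mem_closure ?_ hp hq) ((hcl a ha).resolve_right hH.1)
      ((hcl b hb).resolve_right hH.2.1) fun s' hs' => ?_)
    · rintro _ rfl _ rfl
      rfl
    · exact (hcl s' (hc s' hs')).resolve_right fun h => hH.2.2 ⟨s', hs', h⟩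

theorem survives_of_not_rRel (hC : IsSimpleBlock C L) (hx : x ∈ C) (hy : y ∈ C)
    (h : ¬ RRel x y) : Survives L T x y := by
  refine Survives.of_invariant (fun p q => p ∈ C ∧ q ∈ C ∧ ¬ RRel p q) ?_ ⟨hx, hy, h⟩
  rintro p q ⟨hp, hq, hpq⟩
  refine ⟨fun h => hpq (h ▸ hC.rRel_refl hp), hC.disj p hp, hC.disj q hq, 1,
    fun s hs => absurd hs WithOne.one_ne_coe, hC.mul_mem p hp q hq, hC.mul_mem q hq p hp, ?_⟩
  exact fun h => hpq ((hC.rRel_mul hp (hC.mul_mem p hp q hq)).trans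
    (h.trans (hC.rRel_mul hq (hC.mul_mem q hq p hp)).symm))

theorem survives_of_not_lRel (hC : IsSimpleBlock C L) (hx : x ∈ C) (hy : y ∈ C)
    (h : ¬ LRel x y) : Survives L T x y := by
  refine Survives.of_invariant (fun p q => p ∈ C ∧ q ∈ C ∧ ¬ LRel p q) ?_ ⟨hx, hy, h⟩
  rintro p q ⟨hp, hq, hpq⟩
  refine ⟨fun h => hpq (h ▸ hC.lRel_refl hp), hC.disj p hp, hC.disj q hq, 1,
    fun s hs => absurd hs WithOne.one_ne_coe, hC.mul_mem p hp q hq, hC.mul_mem q hq p hp, ?_⟩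
  exact fun h => hpq ((hC.lRel_mul hp (hC.mul_mem q hq p hp)).trans
    (h.symm.trans (hC.lRel_mul hq (hC.mul_mem p hp q hq)).symm))

/-- If `s` fixes one `ℋ`-class of `C`, then it maps all of `C` to its `ℛ`-class and its
`ℒ`-class: otherwise some parameter `k ∈ C` would make the pair `(s, x)` survive. -/
theorem action_of_fix (hS : HasLocalSurvivors S) (hC : IsSimpleBlock C L)
    (hs : s ∈ actingSet C) (hx : x ∈ C) (hR : RRel (s * x) x) (hL : LRel (x * s) x)
    {k : S} (hk : k ∈ C) : RRel (s * k) x ∧ LRel (k * s) x := by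
  have hnot : ¬ Survives ∅ Set.univ s x := by
    intro h
    obtain ⟨a, ha, b, hb, hab⟩ := hS ∅ (by simp) s x h
    exact hC.not_survives_closure_of_fix hS hs hx hR hL ha hb hab
  have hsk := hs k hk
  have h1 : s * k * x ∈ C := hC.mul_mem _ hsk.1 x hx
  have h2 : x * k * s ∈ C := (hs _ (hC.mul_mem x hx k hk)).2
  constructor
  · by_contra hn
    refine hnot (Survives.of_step (c := k) trivial ((hC.survives_of_not_rRel h1 h2 fun h =>
      hn ?_).mono (Set.empty_subset L) subset_rfl))
    rw [mul_assoc x] at h h2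
    exact (hC.rRel_mul hsk.1 h1).trans (h.trans (hC.rRel_mul hx h2).symm)
  · by_contra hn
    refine hnot (Survives.of_step (c := k) trivial ((hC.survives_of_not_lRel h1 h2 fun h =>
      hn ?_).mono (Set.empty_subset L) subset_rfl))
    rw [mul_assoc x] at h h2
    exact (hC.lRel_mul hsk.2 h2).trans (h.symm.trans (hC.lRel_mul hx h1).symm)

/-- Every element acting on `C` acts like an element of `C`. This yields the pseudo-nilpotent
homomorphism: some idempotent power `e` of `s` fixes the `ℋ`-class of `e x e`, so it maps `C`
to a single `ℛ`-class and a single `ℒ`-class; as `s` commutes with `e`, these are fixed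
by `s`. -/
theorem exists_sameAction (hS : HasLocalSurvivors S) (hC : IsSimpleBlock C L)
    (hs : s ∈ actingSet C) :
    ∃ x ∈ C, ∀ k ∈ C, RRel (s * k) x ∧ LRel (k * s) x := by
  obtain ⟨e, he, hee⟩ := exists_idempotent_mem_closure s
  have heA : e ∈ actingSet C := mem_actingSet_of_mem_closure (by simpa using hs) he
  have hcomm : s * e = e * s := commute_of_mem_closure (A := {s})
    (by rintro _ rfl _ rfl; rfl) (Subsemigroup.subset_closure rfl) he
  obtain ⟨k, hk⟩ := hC.nonempty
  have hx : e * k * e ∈ C := (heA _ (heA k hk).1).2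
  have hex : e * (e * k * e) = e * k * e := by rw [← mul_assoc, ← mul_assoc, hee]
  have hxe : e * k * e * e = e * k * e := by rw [mul_assoc, hee]
  have hfix := fun k' (hk' : k' ∈ C) => hC.action_of_fix hS heA hx
    (by rw [hex]; exact hC.rRel_refl hx) (by rw [hxe]; exact hC.lRel_refl hx) hk'
  have h1 : RRel (s * (e * k * e)) (e * k * e) := by
    have := (hfix _ (hs _ hx).1).1
    rwa [← mul_assoc e s, ← hcomm, mul_assoc s, hex] at this
  have h2 : LRel (e * k * e * s) (e * k * e) := by
    have := (hfix _ (hs _ hx).2).2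
    rwa [mul_assoc _ s e, hcomm, ← mul_assoc _ e s, hxe] at this
  exact ⟨_, hx, fun k' hk' => hC.action_of_fix hS hs hx h1 h2 hk'⟩

theorem sameAction_of_action (hC : IsSimpleBlock C L) (hx : x ∈ C)
    (h : ∀ k ∈ C, RRel (s * k) x ∧ LRel (k * s) x) : SameAction C s x := fun k hk =>
  ⟨(h k hk).1.trans (hC.rRel_mul hx (hC.mul_mem x hx k hk)),
    (h k hk).2.trans (hC.lRel_mul hx (hC.mul_mem k hk x hx))⟩

/-- A product acts on `ℛ`-classes like its left factor, and on `ℒ`-classes like its right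
factor: the pseudo-nilpotent homomorphism takes values in a rectangular band. -/
theorem mul_action (hS : HasLocalSurvivors S) (hC : IsSimpleBlock C L) (hs : s ∈ actingSet C)
    (ht : t ∈ actingSet C) {k : S} (hk : k ∈ C) :
    RRel (s * t * k) (s * k) ∧ LRel (k * (s * t)) (k * t) := by
  obtain ⟨x, -, hx⟩ := hC.exists_sameAction hS hs
  obtain ⟨y, -, hy⟩ := hC.exists_sameAction hS ht
  rw [mul_assoc s t k, ← mul_assoc k s t]
  exact ⟨(hx _ (ht k hk).1).1.trans (hx k hk).1.symm, (hy _ (hs k hk).2).2.trans (hy k hk).2.symm⟩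

/-- Elements with different actions on `C` survive with trivial parameters. -/
theorem survives_of_not_sameAction (hS : HasLocalSurvivors S) (hC : IsSimpleBlock C L)
    (hs : s ∈ actingSet C) (ht : t ∈ actingSet C) (h : ¬ SameAction C s t) :
    Survives L T s t := by
  refine Survives.of_invariant (fun p q => p ∈ actingSet C ∧ q ∈ actingSet C ∧
    ¬ SameAction C p q) ?_ ⟨hs, ht, h⟩
  rintro p q ⟨hp, hq, hpq⟩
  refine ⟨fun h => hpq (h ▸ hC.sameAction_refl hp), hC.notMem_of_mem_actingSet hp,
    hC.notMem_of_mem_actingSet hq, 1, fun s hs => absurd hs WithOne.one_ne_coe,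
    mul_mem_actingSet hp hq, mul_mem_actingSet hq hp, fun h => hpq fun k hk => ?_⟩
  have h1 := hC.mul_action hS hp hq hk
  have h2 := hC.mul_action hS hq hp hk
  exact ⟨h1.1.symm.trans ((h k hk).1.trans h2.1), h2.2.symm.trans ((h k hk).2.symm.trans h1.2)⟩

theorem not_survives_closure_of_sameAction (hS : HasLocalSurvivors S) (hC : IsSimpleBlock C L)
    (hs : s ∈ actingSet C) (hx : x ∈ C) (h : SameAction C s x)
    (ha : a ∈ Subsemigroup.closure ({s, x} : Set S))
    (hb : b ∈ Subsemigroup.closure ({s, x} : Set S)) :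
    ¬ Survives ∅ (Subsemigroup.closure ({s, x} : Set S) : Set S) a b :=
  hC.not_survives_closure_of_fix hS hs hx
    ((h x hx).1.trans (hC.rRel_mul hx (hC.mul_mem x hx x hx)).symm)
    ((h x hx).2.trans (hC.lRel_mul hx (hC.mul_mem x hx x hx)).symm) ha hb

/-- If `⟨s, t⟩` contains elements of `C` that are not `ℋ`-related, then `s` and `t` act
differently on `C`. -/
theorem not_sameAction_of_mem_closure (hS : HasLocalSurvivors S) (hC : IsSimpleBlock C L)
    (ha : a ∈ C) (hb : b ∈ C) (hab : ¬ (RRel a b ∧ LRel a b))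
    (has : a ∈ Subsemigroup.closure ({s, t} : Set S))
    (hbs : b ∈ Subsemigroup.closure ({s, t} : Set S)) :
    s ∈ actingSet C ∧ t ∈ actingSet C ∧ ¬ SameAction C s t := by
  have hpow : ∀ u v : S, u ∉ actingSet C → ∀ p ∈ Subsemigroup.closure ({u, v} : Set S),
      p ∈ Subsemigroup.closure ({v} : Set S) ∨ p ∉ actingSet C := by
    intro u v hu p hp
    induction hp using Subsemigroup.closure_induction with
    | mem p hp =>
      rcases hp with rfl | rfl
      · exact Or.inr hu
      · exact Or.inl (Subsemigroup.subset_closure rfl)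
    | mul p q hp hq ihp ihq =>
      rcases ihp with ihp | ihp
      · rcases ihq with ihq | ihq
        · exact Or.inl (Subsemigroup.mul_mem _ ihp ihq)
        · exact Or.inr fun h => ihq (hC.of_mul_mem_actingSet h).2
      · exact Or.inr fun h => ihp (hC.of_mul_mem_actingSet h).1
  -- commuting elements of `C` are `ℋ`-related
  have hmem : ∀ u v : S, a ∈ Subsemigroup.closure ({u, v} : Set S) →
      b ∈ Subsemigroup.closure ({u, v} : Set S) → u ∈ actingSet C := by
    intro u v hau hbu
    by_contra hu
    have h1 := (hpow u v hu a hau).resolve_right fun h => h (hC.subset_actingSet ha)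
    have h2 := (hpow u v hu b hbu).resolve_right fun h => h (hC.subset_actingSet hb)
    have hcomm : a * b = b * a := commute_of_mem_closure (by rintro _ rfl _ rfl; rfl) h1 h2
    have hm := hC.mul_mem a ha b hb
    have hm' := hC.mul_mem b hb a ha
    have hR := hC.rRel_mul hb hm'
    have hL := hC.lRel_mul ha hm'
    rw [← hcomm] at hR hL
    exact hab ⟨(hC.rRel_mul ha hm).trans hR.symm, hL.trans (hC.lRel_mul hb hm).symm⟩
  have hs := hmem s t has hbs
  have ht := hmem t s (by rwa [Set.pair_comm]) (by rwa [Set.pair_comm])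
  refine ⟨hs, ht, fun hst => hab ((hC.sameAction_iff ha hb).1 ?_)⟩
  have key : ∀ p ∈ Subsemigroup.closure ({s, t} : Set S),
      p ∈ actingSet C ∧ SameAction C p s := by
    intro p hp
    induction hp using Subsemigroup.closure_induction with
    | mem p hp =>
      rcases hp with rfl | rfl
      · exact ⟨hs, hC.sameAction_refl hs⟩
      · exact ⟨ht, hst.symm⟩
    | mul p q hp hq ihp ihq =>
      refine ⟨mul_mem_actingSet ihp.1 ihq.1, fun k hk => ?_⟩
      have h := hC.mul_action hS ihp.1 ihq.1 hk
      exact ⟨h.1.trans (ihp.2 k hk).1, h.2.trans (ihq.2 k hk).2⟩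
  exact (key a has).2.trans (key b hbs).2.symm

theorem exists_not_sameAction (hC : IsSimpleBlock C L) (s : S) :
    ∃ x ∈ C, ¬ SameAction C s x := by
  obtain ⟨x, hx, y, hy, h⟩ := hC.exists_not_related
  by_contra! hn
  exact h ((hC.sameAction_iff hx hy).1 ((hn x hx).symm.trans (hn y hy)))

end IsSimpleBlock

end SimpleBlock

/-! ### Principal series -/

namespace PrincipalSeries

variable {S : Type*} [Semigroup S] (P : PrincipalSeries S)
  {i j k : Fin P.length} {a b s t x y : S}

theorem ideal_antitone {m n : Fin (P.length + 1)} (h : m ≤ n) :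
    (P.ideal n : Set S) ⊆ P.ideal m :=
  (Fin.antitone_iff_succ_le (f := fun n => (P.ideal n : Set S))).2 (fun i => (P.strict i).1) h

theorem upper_subset_lower (h : i < j) : (P.upper j : Set S) ⊆ P.lower i :=
  P.ideal_antitone (Fin.succ_le_castSucc_iff.2 h)

theorem lower_subset_upper (i : Fin P.length) : (P.lower i : Set S) ⊆ P.upper i :=
  (P.strict i).1

theorem cls_nonempty (i : Fin P.length) : (P.cls i).Nonempty :=
  Set.nonempty_of_ssubset (P.strict i)

theorem exists_mem_cls (s : S) : ∃ i, s ∈ P.cls i := by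
  by_contra! h
  have key : ∀ n : Fin (P.length + 1), s ∈ (P.ideal n : Set S) := by
    intro n
    induction n using Fin.induction with
    | zero => rw [P.first]; trivial
    | succ i ih => exact by_contra fun hn => h i ⟨ih, hn⟩
  have := key (Fin.last _)
  rw [P.last] at this
  exact this

theorem le_of_mem_cls_of_mem_upper (hs : s ∈ P.cls i) (h : s ∈ (P.upper j : Set S)) : j ≤ i := by
  by_contra hn
  exact hs.2 (P.upper_subset_lower (not_le.1 hn) h)

theorem eq_of_mem_cls (hi : s ∈ P.cls i) (hj : s ∈ P.cls j) : i = j :=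
  le_antisymm (P.le_of_mem_cls_of_mem_upper hj hi.1) (P.le_of_mem_cls_of_mem_upper hi hj.1)

theorem lower_isIdeal (i : Fin P.length) :
    ∀ s, ∀ t ∈ (P.lower i : Set S), s * t ∈ (P.lower i : Set S) ∧ t * s ∈ (P.lower i : Set S) :=
  fun s _ ht => ⟨(P.lower i).mul_mem_left s ht, (P.lower i).mul_mem_right s ht⟩

theorem upper_isIdeal (i : Fin P.length) :
    ∀ s, ∀ t ∈ (P.upper i : Set S), s * t ∈ (P.upper i : Set S) ∧ t * s ∈ (P.upper i : Set S) :=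
  fun s _ ht => ⟨(P.upper i).mul_mem_left s ht, (P.upper i).mul_mem_right s ht⟩

theorem cls_mul (i : Fin P.length) : ∀ s, ∀ x ∈ P.cls i,
    (s * x ∈ P.cls i ∨ s * x ∈ (P.lower i : Set S)) ∧
      (x * s ∈ P.cls i ∨ x * s ∈ (P.lower i : Set S)) := by
  intro s x hx
  obtain ⟨h1, h2⟩ := P.upper_isIdeal i s x hx.1
  exact ⟨or_iff_not_imp_right.2 fun h => ⟨h1, h⟩, or_iff_not_imp_right.2 fun h => ⟨h2, h⟩⟩

/-- The principal classes are `𝒥`-classes: for `x` in `S_i \ S_{i+1}` the ideal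
`S_{i+1} ∪ S¹ x S¹` cannot lie strictly between `S_{i+1}` and `S_i`. -/
theorem cls_jclass (i : Fin P.length) : ∀ x ∈ P.cls i, ∀ y ∈ P.cls i,
    ∃ u v : WithOne S, (y : WithOne S) = u * x * v := by
  intro x hx y hy
  let J : SIdeal S :=
    { carrier := {z | z ∈ (P.lower i : Set S) ∨
        ∃ u v : WithOne S, (z : WithOne S) = u * x * v}
      mul_mem_left := by
        rintro s t (h | ⟨u, v, h⟩)
        · exact Or.inl (P.lower_isIdeal i s t h).1
        · exact Or.inr ⟨s * u, v, by rw [WithOne.coe_mul, h]; simp only [mul_assoc]⟩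
      mul_mem_right := by
        rintro t s (h | ⟨u, v, h⟩)
        · exact Or.inl (P.lower_isIdeal i s t h).2
        · exact Or.inr ⟨u, v * s, by rw [WithOne.coe_mul, h]; simp only [mul_assoc]⟩
      mul_mem' := by
        rintro s t - (h | ⟨u, v, h⟩)
        · exact Or.inl (P.lower_isIdeal i s t h).1
        · exact Or.inr ⟨s * u, v, by rw [WithOne.coe_mul, h]; simp only [mul_assoc]⟩ }
  have hle : (J : Set S) ⊆ P.upper i := by
    rintro z (h | ⟨u, v, h⟩)
    · exact P.lower_subset_upper i h
    · have h1 : ∃ p : S, (p : WithOne S) = u * x ∧ p ∈ (P.upper i : Set S) := by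
        induction u using WithOne.recOneCoe with
        | one => exact ⟨x, (one_mul _).symm, hx.1⟩
        | coe u => exact ⟨u * x, WithOne.coe_mul _ _, (P.upper_isIdeal i u x hx.1).1⟩
      obtain ⟨p, hp, hpu⟩ := h1
      rw [← hp] at h
      induction v using WithOne.recOneCoe with
      | one =>
        rw [mul_one, WithOne.coe_inj] at h
        exact h ▸ hpu
      | coe v =>
        rw [← WithOne.coe_mul, WithOne.coe_inj] at h
        exact h ▸ (P.upper_isIdeal i v p hpu).2
  have hlt : (P.lower i : Set S) ⊂ J :=
    ⟨fun z hz => Or.inl hz, fun h => hx.2 (h (Or.inr ⟨1, 1, by simp⟩))⟩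
  have hge : (P.upper i : Set S) ⊆ J := by
    by_contra hn
    exact P.nothing_between i J ⟨hlt, hle, hn⟩
  exact (hge hy.1).resolve_left hy.2

theorem not_factorNilpotent_iff [Finite S] (i : Fin P.length) :
    ¬ P.FactorNilpotent i ↔ ∃ a ∈ (P.upper i : Set S), ∃ b ∈ (P.upper i : Set S),
      Survives (P.lower i : Set S) (P.upper i : Set S) a b :=
  not_isMalcevNilpotent_iff_survives (P.lower_isIdeal i) (P.upper i).toSubsemigroup
    ((P.lower i).restrict (P.upper i).toSubsemigroup).toReesHom
    (fun q => Con.induction_on q fun x => ⟨x, rfl⟩) (fun _ _ => SIdeal.toReesFactor_eq_iff _)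

/-- The principal classes whose factor is not nilpotent are completely simple. -/
theorem isSimpleBlock [Finite S] (hS : HasLocalSurvivors S) (hi : ¬ P.FactorNilpotent i) :
    IsSimpleBlock (P.cls i) (P.lower i) := by
  obtain ⟨a, ha, b, hb, hab⟩ := (P.not_factorNilpotent_iff i).1 hi
  have ha' : a ∈ P.cls i := ⟨ha, hab.notMem_left⟩
  have hb' : b ∈ P.cls i := ⟨hb, hab.notMem_right⟩
  have hreg : IsRegularBlock (P.cls i) (P.lower i) := by
    obtain ⟨c, -, h⟩ := hab.step
    have h1 : sandwich a c b ∉ (P.lower i : Set S) := h.notMem_left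
    have key : ∀ p ∈ P.cls i, p * b ∉ (P.lower i : Set S) →
        IsRegularBlock (P.cls i) (P.lower i) := fun p hp hpb =>
      isRegularBlock_of_mul_mem (P.lower_isIdeal i) (P.cls_mul i) (fun x hx => hx.2)
        (P.cls_jclass i) hp hb' ((P.cls_mul i p b hb').1.resolve_right hpb)
    induction c using WithOne.recOneCoe with
    | one => exact key a ha' h1
    | coe c =>
      exact key (a * c) ((P.cls_mul i c a ha').2.resolve_right fun h =>
        h1 (P.lower_isIdeal i b _ h).2) h1
  refine ⟨hreg, fun x hx y hy => hreg.mul_mem_of_survives hS ?_ ha' hb' hab hx hy,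
    a, ha', b, hb', fun h => not_survives_of_rRel_lRel hS h.1 h.2
      (hab.mono (Set.empty_subset _) (Set.subset_univ _))⟩
  intro s hs
  by_cases h : s ∈ (P.lower i : Set S)
  exacts [Or.inr h, Or.inl ⟨hs, h⟩]

/-- Surviving pairs live in principal classes whose factor is not nilpotent: take a surviving
pair in the smallest possible ideal of the series. -/
theorem exists_cls_of_survives [Finite S] (hS : HasLocalSurvivors S) {T : Subsemigroup S}
    (ha : a ∈ T) (hb : b ∈ T) (hab : Survives ∅ (T : Set S) a b) :
    ∃ i, ¬ P.FactorNilpotent i ∧ ∃ x ∈ P.cls i, ∃ y ∈ P.cls i, x ∈ T ∧ y ∈ T ∧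
      ¬ (RRel x y ∧ LRel x y) := by
  let A : Set (Fin P.length) := {k | ∃ x ∈ T, ∃ y ∈ T, x ∈ (P.upper k : Set S) ∧
    y ∈ (P.upper k : Set S) ∧ Survives ∅ (T : Set S) x y}
  have hA : A.Nonempty := by
    obtain ⟨i, -⟩ := P.exists_mem_cls a
    have h0 : (P.upper ⟨0, i.pos⟩ : Set S) = Set.univ := by
      rw [← P.first]
      congr 2
    exact ⟨⟨0, i.pos⟩, a, ha, b, hb, h0 ▸ trivial, h0 ▸ trivial, hab⟩
  obtain ⟨i, ⟨x, hx, y, hy, hxi, hyi, hxy⟩, hmax⟩ :=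
    WellFounded.has_min (wellFounded_gt (α := Fin P.length)) A hA
  have hlow : ∀ p ∈ T, ∀ q ∈ T, p ∈ (P.lower i : Set S) → ¬ Survives ∅ (T : Set S) p q := by
    intro p hp q hq hpi hpq
    obtain ⟨c, hc, h⟩ := hpq.step
    have h1 : i.succ ≠ Fin.last P.length := by
      intro h
      have h' : p ∈ (P.ideal i.succ : Set S) := hpi
      rw [h, P.last] at h'
      exact h'
    obtain ⟨k, hk⟩ := Fin.exists_castSucc_eq.2 h1
    have hki : P.upper k = P.lower i := congrArg P.ideal hk
    refine hmax k ⟨_, sandwich_mem hp hq hc, _, sandwich_mem hq hp hc, ?_, ?_, h⟩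
      (Fin.succ_le_castSucc_iff.1 hk.ge)
    · rw [hki]
      exact sandwich_mem_ideal_left (P.lower_isIdeal i) c hpi
    · rw [hki]
      exact sandwich_mem_ideal_right (P.lower_isIdeal i) c hpi
  have hxy' : Survives (P.lower i : Set S) (T : Set S) x y := by
    refine Survives.of_invariant
      (fun p q => p ∈ T ∧ q ∈ T ∧ Survives ∅ (T : Set S) p q) ?_ ⟨hx, hy, hxy⟩
    rintro p q ⟨hp, hq, hpq⟩
    obtain ⟨c, hc, h⟩ := hpq.step
    exact ⟨hpq.ne, fun h => hlow p hp q hq h hpq, fun h => hlow q hq p hp h hpq.symm, c, hc,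
      sandwich_mem hp hq hc, sandwich_mem hq hp hc, h⟩
  have hle : Subsemigroup.closure ({x, y} : Set S) ≤ (P.upper i).toSubsemigroup := by
    rw [Subsemigroup.closure_le]
    rintro _ (rfl | rfl)
    exacts [hxi, hyi]
  obtain ⟨p, hp, q, hq, hpq⟩ := hS _ (P.lower_isIdeal i) x y
    (hxy'.mono subset_rfl (Set.subset_univ _))
  exact ⟨i, (P.not_factorNilpotent_iff i).2 ⟨p, hle hp, q, hle hq, hpq.mono subset_rfl hle⟩,
    x, ⟨hxi, hxy'.notMem_left⟩, y, ⟨hyi, hxy'.notMem_right⟩, hx, hy,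
    fun h => not_survives_of_rRel_lRel hS h.1 h.2 (hxy.mono subset_rfl (Set.subset_univ _))⟩

/-- Two elements are joined in the upper non-nilpotent graph exactly when they act differently
on some principal class whose factor is not nilpotent. -/
theorem adj_iff [Finite S] (hS : HasLocalSurvivors S) :
    (upperNonNilpotentGraph S).Adj x y ↔ ∃ i, ¬ P.FactorNilpotent i ∧
      x ∈ actingSet (P.cls i) ∧ y ∈ actingSet (P.cls i) ∧ ¬ SameAction (P.cls i) x y := by
  constructor
  · rintro ⟨-, h⟩
    obtain ⟨a, ha, b, hb, hab⟩ := (not_isMalcevNilpotent_coe_iff_survives _).1 h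
    obtain ⟨i, hi, p, hp, q, hq, hpT, hqT, hpq⟩ := P.exists_cls_of_survives hS ha hb hab
    exact ⟨i, hi, (P.isSimpleBlock hS hi).not_sameAction_of_mem_closure hS hp hq hpq hpT hqT⟩
  · rintro ⟨i, hi, hx, hy, hxy⟩
    have h := (P.isSimpleBlock hS hi).survives_of_not_sameAction hS hx hy hxy
      (T := (Subsemigroup.closure ({x, y} : Set S) : Set S))
    exact ⟨h.ne, (not_isMalcevNilpotent_coe_iff_survives _).2
      ⟨x, Subsemigroup.subset_closure (Or.inl rfl), y, Subsemigroup.subset_closure (Or.inr rfl),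
        h.mono (Set.empty_subset _) subset_rfl⟩⟩

/-- In the graph of `S / S_{i+1}`, an element acting on a completely simple class
`S_i \ S_{i+1}` is joined to exactly those elements of the class that act differently. -/
theorem adj_toReesFactor_iff [Finite S] (hS : HasLocalSurvivors S) (hi : ¬ P.FactorNilpotent i)
    (hs : s ∈ actingSet (P.cls i)) (hx : x ∈ P.cls i) :
    (upperNonNilpotentGraph (P.lower i).ReesFactor).Adj
      ((P.lower i).toReesFactor s) ((P.lower i).toReesFactor x) ↔
        ¬ SameAction (P.cls i) s x := by
  have hC := P.isSimpleBlock hS hi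
  have hgen := not_isMalcevNilpotent_closure_iff_survives (P.lower_isIdeal i) ⊤
    ((P.lower i).toReesHom.comp (MulMemClass.subtype (⊤ : Subsemigroup S)))
    (fun u v => by rw [Subtype.ext_iff]; exact SIdeal.toReesFactor_eq_iff _) 
    ⟨s, trivial⟩ ⟨x, trivial⟩
  constructor
  · rintro ⟨-, h⟩ hsx
    obtain ⟨a, ha, b, hb, hab⟩ := hgen.1 h
    exact hC.not_survives_closure_of_sameAction hS hs hx hsx ha hb
      (hab.mono (Set.empty_subset _) subset_rfl)
  · intro hsx
    have h := hC.survives_of_not_sameAction hS hs (hC.subset_actingSet hx) hsx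
      (T := (Subsemigroup.closure ({s, x} : Set S) : Set S))
    refine ⟨fun heq => ?_, hgen.2 ⟨s, Subsemigroup.subset_closure (Or.inl rfl), x,
      Subsemigroup.subset_closure (Or.inr rfl), h⟩⟩
    rcases (SIdeal.toReesFactor_eq_iff _).1 heq with h' | h'
    exacts [h.ne h', h.notMem_left h'.1]

/-! ### Stems, roots and isolated subsets -/

theorem cls_subset_stem_iff : P.cls j ⊆ P.stem i ↔
    j ≤ i ∧ P.cls j ⊆ P.actors i ∪ P.cls i := by
  constructor
  · intro h
    obtain ⟨s, hs⟩ := P.cls_nonempty j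
    obtain ⟨k, hk, hsk⟩ := Set.mem_iUnion₂.1 (h hs)
    rwa [P.eq_of_mem_cls hs hsk]
  · exact fun h => Set.subset_iUnion₂_of_subset j h subset_rfl

/-- An element acting non-trivially on `S_i \ S_{i+1}` has a multiple there. If this multiple
acts non-trivially on a further class, then so does the element itself. -/
theorem cls_subset_stem_trans (hij : P.cls i ⊆ P.stem j) (hjk : P.cls j ⊆ P.stem k) :
    P.cls i ⊆ P.stem k := by
  rw [cls_subset_stem_iff] at *
  obtain ⟨hij, h1⟩ := hij
  obtain ⟨hjk, h2⟩ := hjk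
  refine ⟨hij.trans hjk, fun a ha => ?_⟩
  rcases h1 ha with ⟨haj, x, hx, hax⟩ | haj
  · have hak : a ∉ P.upper k := fun h =>
      haj (P.ideal_antitone (Fin.castSucc_le_castSucc_iff.2 hjk) h)
    rcases hjk.eq_or_lt with rfl | hlt
    · exact Or.inl ⟨hak, x, hx, hax⟩
    have hact : ∀ y ∈ P.cls j, ∃ z ∈ P.cls k, y * z ∉ P.lower k ∨ z * y ∉ P.lower k := by
      intro y hy
      rcases h2 hy with h | h
      · exact h.2
      · exact absurd (P.eq_of_mem_cls hy h) hlt.ne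
    refine Or.inl ⟨hak, ?_⟩
    rcases hax with hax | hax
    · obtain ⟨z, hz, hyz⟩ := hact _ ((P.cls_mul j a x hx).1.resolve_right hax)
      rcases hyz with h | h
      · refine ⟨x * z, (P.cls_mul k x z hz).1.resolve_right fun hn => h ?_, Or.inl ?_⟩
        · rw [mul_assoc]; exact (P.lower_isIdeal k a _ hn).1
        · rwa [← mul_assoc]
      · refine ⟨z, hz, Or.inr fun hn => h ?_⟩
        rw [← mul_assoc]; exact (P.lower_isIdeal k x _ hn).2
    · obtain ⟨z, hz, hyz⟩ := hact _ ((P.cls_mul j a x hx).2.resolve_right hax)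
      rcases hyz with h | h
      · refine ⟨z, hz, Or.inl fun hn => h ?_⟩
        rw [mul_assoc]; exact (P.lower_isIdeal k x _ hn).1
      · refine ⟨z * x, (P.cls_mul k x z hz).2.resolve_right fun hn => h ?_, Or.inr ?_⟩
        · rw [← mul_assoc]; exact (P.lower_isIdeal k a _ hn).2
        · rwa [mul_assoc]
  · rw [P.eq_of_mem_cls ha haj] at ha
    exact h2 ha

section Finite

variable [Finite S] (hS : HasLocalSurvivors S)

include hS

theorem actors_union_cls (hi : ¬ P.FactorNilpotent i) :
    P.actors i ∪ P.cls i = actingSet (P.cls i) := by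
  have hC := P.isSimpleBlock hS hi
  ext s
  constructor
  · rintro (⟨-, x, hx, h | h⟩ | h)
    · exact hC.mem_actingSet_of_mul_left hx h
    · exact hC.mem_actingSet_of_mul_right hx h
    · exact hC.subset_actingSet h
  · intro hs
    by_cases hu : s ∈ P.upper i
    · exact Or.inr ⟨hu, hC.notMem_of_mem_actingSet hs⟩
    · obtain ⟨x, hx⟩ := hC.nonempty
      exact Or.inl ⟨hu, x, hx, Or.inl (hs x hx).1.2⟩

theorem le_of_mem_actingSet (hi : ¬ P.FactorNilpotent i) (hs : s ∈ P.cls j)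
    (hsi : s ∈ actingSet (P.cls i)) : j ≤ i := by
  obtain ⟨x, hx⟩ := (P.isSimpleBlock hS hi).nonempty
  exact P.le_of_mem_cls_of_mem_upper (hsi x hx).1 (P.upper_isIdeal j x s hs.1).2

theorem cls_subset_actingSet (hi : ¬ P.FactorNilpotent i) (hs : s ∈ P.cls j)
    (hsi : s ∈ actingSet (P.cls i)) : P.cls j ⊆ actingSet (P.cls i) := by
  intro t ht
  have hC := P.isSimpleBlock hS hi
  obtain ⟨u, v, h⟩ := P.cls_jclass j t ht s hs
  induction u using WithOne.recOneCoe with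
  | one =>
    rw [one_mul] at h
    induction v using WithOne.recOneCoe with
    | one =>
      rw [mul_one, WithOne.coe_inj] at h
      exact h ▸ hsi
    | coe v =>
      rw [← WithOne.coe_mul, WithOne.coe_inj] at h
      exact (hC.of_mul_mem_actingSet (h ▸ hsi)).1
  | coe u =>
    rw [← WithOne.coe_mul] at h
    induction v using WithOne.recOneCoe with
    | one =>
      rw [mul_one, WithOne.coe_inj] at h
      exact (hC.of_mul_mem_actingSet (h ▸ hsi)).2
    | coe v =>
      rw [← WithOne.coe_mul, WithOne.coe_inj] at h
      exact (hC.of_mul_mem_actingSet (hC.of_mul_mem_actingSet (h ▸ hsi)).1).2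

theorem stem_eq (hi : ¬ P.FactorNilpotent i) : P.stem i = actingSet (P.cls i) := by
  ext s
  constructor
  · intro hs
    obtain ⟨k, hk, hsk⟩ := Set.mem_iUnion₂.1 hs
    rw [← P.actors_union_cls hS hi]
    exact hk.2 hsk
  · intro hs
    obtain ⟨j, hj⟩ := P.exists_mem_cls s
    refine Set.mem_iUnion₂.2 ⟨j, ⟨P.le_of_mem_actingSet hS hi hj hs, ?_⟩, hj⟩
    rw [P.actors_union_cls hS hi]
    exact P.cls_subset_actingSet hS hi hj hs

theorem actingSet_subset_actingSet (hj : ¬ P.FactorNilpotent j)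
    (h : P.cls i ⊆ actingSet (P.cls j)) : actingSet (P.cls i) ⊆ actingSet (P.cls j) := by
  intro s hs
  obtain ⟨x, hx⟩ := P.cls_nonempty i
  exact ((P.isSimpleBlock hS hj).of_mul_mem_actingSet (h (hs x hx).1)).1

/-- A class is a root when it is maximal among the classes with non-nilpotent factor, ordered
by inclusion of their acting sets. -/
theorem isRoot_iff : P.IsRoot i ↔ ¬ P.FactorNilpotent i ∧
    ∀ j, i < j → ¬ P.FactorNilpotent j → ¬ P.cls i ⊆ actingSet (P.cls j) := by
  refine and_congr_right fun hi => ⟨fun h j hij hj hsub => ?_, fun h a ha b hb hab => ?_⟩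
  · obtain ⟨a, ha⟩ := P.cls_nonempty i
    have hC := P.isSimpleBlock hS hj
    obtain ⟨b, hb, hab⟩ := hC.exists_not_sameAction a
    exact h a ha b (P.upper_subset_lower hij hb.1)
      ((P.adj_iff hS).2 ⟨j, hj, hsub ha, hC.subset_actingSet hb, hab⟩)
  · obtain ⟨j, hj, haj, hbj, -⟩ := (P.adj_iff hS).1 hab
    obtain ⟨k, hk⟩ := P.exists_mem_cls b
    have hik : i < k := by
      by_contra hn
      rcases (not_lt.1 hn).eq_or_lt with rfl | hlt
      · exact hk.2 hb
      · exact hk.2 (P.upper_subset_lower hlt (P.lower_subset_upper i hb))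
    exact h j (hik.trans_le (P.le_of_mem_actingSet hS hj hk hbj)) hj
      (P.cls_subset_actingSet hS hj ha haj)

theorem exists_isRoot_actingSet_subset (hi : ¬ P.FactorNilpotent i) :
    ∃ r, P.IsRoot r ∧ actingSet (P.cls i) ⊆ actingSet (P.cls r) := by
  obtain ⟨r, ⟨hr, hir⟩, hmax⟩ := WellFounded.has_min (wellFounded_gt (α := Fin P.length))
    {k | ¬ P.FactorNilpotent k ∧ actingSet (P.cls i) ⊆ actingSet (P.cls k)} ⟨i, hi, subset_rfl⟩
  exact ⟨r, (P.isRoot_iff hS).2 ⟨hr, fun j hrj hj hsub => hmax j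
    ⟨hj, hir.trans (P.actingSet_subset_actingSet hS hj hsub)⟩ hrj⟩, hir⟩

theorem isIsolatedClass_iff : P.IsIsolatedClass i ↔
    ∀ j, ¬ P.FactorNilpotent j → ¬ P.cls i ⊆ actingSet (P.cls j) := by
  constructor
  · rintro ⟨h1, h2⟩ j hj hsub
    have hC := P.isSimpleBlock hS hj
    have key : ∀ j, i ≠ j → ¬ P.FactorNilpotent j → ¬ P.cls i ⊆ actingSet (P.cls j) := by
      intro j hij hj hsub
      refine hj (h2 j fun s hs => ?_)
      rw [← P.actors_union_cls hS hj] at hsub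
      exact (hsub hs).resolve_right fun h => hij (P.eq_of_mem_cls hs h)
    obtain rfl : i = j := by_contra fun hij => key j hij hj hsub
    exact h1 ((P.isRoot_iff hS).2 ⟨hj, fun k hk hkn => key k hk.ne hkn⟩)
  · refine fun h => ⟨fun hr => h i hr.1 (P.isSimpleBlock hS hr.1).subset_actingSet, ?_⟩
    intro j hj
    by_contra hn
    refine h j hn ?_
    rw [← P.actors_union_cls hS hn]
    exact hj.trans Set.subset_union_left

theorem mem_isolatedUnion_iff : s ∈ P.isolatedUnion ↔
    ∀ j, ¬ P.FactorNilpotent j → s ∉ actingSet (P.cls j) := by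
  constructor
  · intro hs j hj hsj
    obtain ⟨i, hi, hsi⟩ := Set.mem_iUnion₂.1 hs
    exact (P.isIsolatedClass_iff hS).1 hi j hj (P.cls_subset_actingSet hS hj hsi hsj)
  · intro h
    obtain ⟨i, hi⟩ := P.exists_mem_cls s
    exact Set.mem_iUnion₂.2 ⟨i, (P.isIsolatedClass_iff hS).2 fun j hj hsub => h j hj (hsub hi), hi⟩

theorem notMem_isolatedUnion_iff : s ∉ P.isolatedUnion ↔ ∃ r, P.IsRoot r ∧ s ∈ P.stem r := by
  rw [P.mem_isolatedUnion_iff hS]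
  push Not
  constructor
  · rintro ⟨j, hj, hs⟩
    obtain ⟨r, hr, hjr⟩ := P.exists_isRoot_actingSet_subset hS hj
    exact ⟨r, hr, P.stem_eq hS hr.1 ▸ hjr hs⟩
  · rintro ⟨r, hr, hs⟩
    exact ⟨r, hr.1, P.stem_eq hS hr.1 ▸ hs⟩

/-- The union of the isolated subsets, as an ideal. -/
def isolatedIdeal : SIdeal S where
  carrier := P.isolatedUnion
  mul_mem_left _ _ ht := (P.mem_isolatedUnion_iff hS).2 fun j hj h =>
    (P.mem_isolatedUnion_iff hS).1 ht j hj ((P.isSimpleBlock hS hj).of_mul_mem_actingSet h).2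
  mul_mem_right _ ht := (P.mem_isolatedUnion_iff hS).2 fun j hj h =>
    (P.mem_isolatedUnion_iff hS).1 ht j hj ((P.isSimpleBlock hS hj).of_mul_mem_actingSet h).1
  mul_mem' _ ht := (P.mem_isolatedUnion_iff hS).2 fun j hj h =>
    (P.mem_isolatedUnion_iff hS).1 ht j hj ((P.isSimpleBlock hS hj).of_mul_mem_actingSet h).2

theorem isMalcevNilpotent_isolatedIdeal :
    IsMalcevNilpotent (P.isolatedIdeal hS).toSubsemigroup := by
  by_contra h
  obtain ⟨a, ha, b, hb, hab⟩ := (not_isMalcevNilpotent_coe_iff_survives _).1 h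
  obtain ⟨i, hi, x, hx, -, -, hxK, -⟩ := P.exists_cls_of_survives hS ha hb hab
  exact (P.mem_isolatedUnion_iff hS).1 hxK i hi ((P.isSimpleBlock hS hi).subset_actingSet hx)

theorem subset_isolatedUnion_of_isMalcevNilpotent (J : SIdeal S)
    (hJ : IsMalcevNilpotent J.toSubsemigroup) : (J : Set S) ⊆ P.isolatedUnion := by
  intro s hs
  refine (P.mem_isolatedUnion_iff hS).2 fun j hj hsj => ?_
  have hC := P.isSimpleBlock hS hj
  -- an ideal that meets the acting set of a class contains the whole class
  have hsub : ∀ x ∈ P.cls j, x ∈ (J : Set S) := by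
    intro x hx
    obtain ⟨u, v, h⟩ := hC.jclass _ (hsj x hx).1 x hx
    rw [h]
    exact J.mul_mem_right v (J.mul_mem_left u (J.mul_mem_right x hs))
  obtain ⟨x, hx⟩ := hC.nonempty
  obtain ⟨y, hy, hxy⟩ := hC.exists_not_sameAction x
  exact (not_isMalcevNilpotent_coe_iff_survives _).2 ⟨x, hsub x hx, y, hsub y hy,
    (hC.survives_of_not_sameAction hS (hC.subset_actingSet hx) (hC.subset_actingSet hy)
      hxy).mono (Set.empty_subset _) subset_rfl⟩ hJ

theorem isolatedUnion_eq_isolated_vertices :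
    P.isolatedUnion = {v : S | ∀ u : S, ¬ (upperNonNilpotentGraph S).Adj v u} := by
  ext v
  rw [P.mem_isolatedUnion_iff hS, Set.mem_ofPred_eq]
  constructor
  · intro h u hu
    obtain ⟨i, hi, hv, -⟩ := (P.adj_iff hS).1 hu
    exact h i hi hv
  · intro h j hj hv
    have hC := P.isSimpleBlock hS hj
    obtain ⟨x, hx, hvx⟩ := hC.exists_not_sameAction v
    exact h x ((P.adj_iff hS).2 ⟨j, hj, hv, hC.subset_actingSet hx, hvx⟩)

theorem mul_mem_stem_iff (hi : P.IsRoot i) : a * b ∈ P.stem i ↔ a ∈ P.stem i ∧ b ∈ P.stem i := by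
  rw [P.stem_eq hS hi.1]
  exact ⟨(P.isSimpleBlock hS hi.1).of_mul_mem_actingSet, fun h => mul_mem_actingSet h.1 h.2⟩

theorem cls_subset_stem_of_mem (hi : P.IsRoot i) (ha : a ∈ P.cls j) (hai : a ∈ P.stem i) :
    P.cls j ⊆ P.stem i := by
  rw [P.stem_eq hS hi.1] at *
  exact P.cls_subset_actingSet hS hi.1 ha hai

end Finite

end PrincipalSeries

/-! ### The pseudo-nilpotent homomorphisms -/

namespace ReesPresentation

variable {S : Type*} [Semigroup S] {P : PrincipalSeries S} {i : Fin P.length}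
  {G I Λ : Type*} [Group G] (R : ReesPresentation P i G I Λ) {a : S}

theorem el_mem (g : G) (q : I × Λ) : R.el g q ∈ P.cls i := by
  rw [← R.range_eq]
  exact ⟨_, rfl⟩

theorem el_mul_el (g h : G) (q r : I × Λ) :
    R.el g q * R.el h r = R.el (g * R.mat q.2 r.1 * h) (q.1, r.2) :=
  (map_mul R.toHom ⟨g, q.1, q.2⟩ ⟨h, r.1, r.2⟩).symm

theorem el_inj {g h : G} {q r : I × Λ} (heq : R.el g q = R.el h r) : q = r := by
  have := R.injective heq
  rw [ReesMatrix.mk.injEq] at this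
  exact Prod.ext this.2.1 this.2.2

theorem exists_el {x : S} (hx : x ∈ P.cls i) : ∃ g q, R.el g q = x := by
  rw [← R.range_eq] at hx
  obtain ⟨⟨g, e, f⟩, rfl⟩ := hx
  exact ⟨g, (e, f), rfl⟩

variable [Finite S] (hS : HasLocalSurvivors S) (hi : ¬ P.FactorNilpotent i)

include hS hi

/-- In a Rees matrix semigroup the `ℋ`-classes are given by the pairs of indices. -/
theorem sameAction_el_iff {g h : G} {q r : I × Λ} :
    SameAction (P.cls i) (R.el g q) (R.el h r) ↔ q = r := by
  have hC := P.isSimpleBlock hS hi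
  constructor
  · intro hact
    obtain ⟨⟨⟨s, hs⟩, -⟩, ⟨t, ht⟩, -⟩ := hact _ (R.el_mem 1 q)
    -- multiply by an element of the class, so that the factor `s` or `t` lies in the class
    have hm := fun x (hx : x ∈ P.cls i) y (hy : y ∈ P.cls i) => hC.mul_mem x hx y hy
    have hs' : R.el 1 q * s ∈ P.cls i := by
      refine hC.mul_mem_of_left (R.el_mem _ _) fun hn => hC.disj _
        (hm _ (R.el_mem h r) _ (R.el_mem 1 q)) ?_
      rw [← hs, mul_assoc]
      exact (hC.lower _ _ hn).1
    have ht' : t * R.el 1 q ∈ P.cls i := by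
      refine hC.mul_mem_of_right (R.el_mem _ _) fun hn => hC.disj _
        (hm _ (R.el_mem 1 q) _ (R.el_mem h r)) ?_
      rw [← ht, ← mul_assoc]
      exact (hC.lower _ _ hn).2
    obtain ⟨g₁, q₁, h₁⟩ := R.exists_el hs'
    obtain ⟨g₂, q₂, h₂⟩ := R.exists_el ht'
    rw [mul_assoc, ← h₁, el_mul_el, el_mul_el] at hs
    rw [← mul_assoc, ← h₂, el_mul_el, el_mul_el] at ht
    exact Prod.ext (Prod.ext_iff.1 (R.el_inj hs)).1 (Prod.ext_iff.1 (R.el_inj ht)).2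
  · rintro rfl
    rw [hC.sameAction_iff (R.el_mem _ _) (R.el_mem _ _)]
    have hR : ∀ g h : G, R.el g q * R.el ((g * R.mat q.2 q.1)⁻¹ * h) q = R.el h q := by
      intro g h
      rw [el_mul_el, mul_inv_cancel_left]
    have hL : ∀ g h : G, R.el (h * (R.mat q.2 q.1 * g)⁻¹) q * R.el g q = R.el h q := by
      intro g h
      rw [el_mul_el, mul_assoc _ _ g, inv_mul_cancel_right]
    exact ⟨⟨⟨_, hR g h⟩, _, hR h g⟩, ⟨_, hL g h⟩, _, hL h g⟩

theorem isPairOf_iff (ha : a ∈ actingSet (P.cls i)) (q : I × Λ) :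
    R.IsPairOf a q ↔ SameAction (P.cls i) a (R.el 1 q) := by
  have hadj := fun (g : G) (q : I × Λ) => P.adj_toReesFactor_iff hS hi ha (R.el_mem g q)
  constructor
  · intro h
    exact not_not.1 fun hn => h.1 1 ((hadj 1 q).2 hn)
  · refine fun h => ⟨fun g hg => (hadj g q).1 hg (h.trans ((R.sameAction_el_iff hS hi).2 rfl)),
      fun q' hq' g => (hadj g q').2 fun h' => hq' ?_⟩
    exact (R.sameAction_el_iff hS hi).1 (h'.symm.trans h)

theorem phi_eq_iff (ha : a ∈ actingSet (P.cls i)) (q : I × Λ) :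
    R.Phi a = q ↔ SameAction (P.cls i) a (R.el 1 q) := by
  have hC := P.isSimpleBlock hS hi
  obtain ⟨x, hx, hax⟩ := hC.exists_sameAction hS ha
  obtain ⟨g, r, rfl⟩ := R.exists_el hx
  have har : SameAction (P.cls i) a (R.el 1 r) :=
    (hC.sameAction_of_action hx hax).trans ((R.sameAction_el_iff hS hi).2 rfl)
  have hex : a ∈ P.actors i ∪ P.cls i ∧ ∃ q, R.IsPairOf a q :=
    ⟨by rwa [P.actors_union_cls hS hi], r, (R.isPairOf_iff hS hi ha r).2 har⟩
  have hch := (R.isPairOf_iff hS hi ha _).1 (Classical.choose_spec hex.2)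
  rw [Phi, dif_pos hex, WithZero.coe_inj]
  constructor
  · intro h
    rwa [h] at hch
  · intro h
    exact (R.sameAction_el_iff hS hi).1 (hch.symm.trans h)

theorem exists_phi_eq (ha : a ∈ actingSet (P.cls i)) : ∃ q : I × Λ, R.Phi a = q := by
  have hC := P.isSimpleBlock hS hi
  obtain ⟨x, hx, hax⟩ := hC.exists_sameAction hS ha
  obtain ⟨g, r, rfl⟩ := R.exists_el hx
  exact ⟨r, (R.phi_eq_iff hS hi ha r).2
    ((hC.sameAction_of_action hx hax).trans ((R.sameAction_el_iff hS hi).2 rfl))⟩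

end ReesPresentation

theorem mainTheorem1 {S : Type*} [Semigroup S] [Finite S] (hS : IsPseudoNilpotent S)
    (P : PrincipalSeries S) :
    -- (1) `K` is the largest nilpotent ideal and the set of isolated vertices
    ((∃ K : SIdeal S, (K : Set S) = P.isolatedUnion ∧
        IsMalcevNilpotent K.toSubsemigroup ∧
        ∀ J : SIdeal S, IsMalcevNilpotent J.toSubsemigroup → (J : Set S) ⊆ K) ∧
      P.isolatedUnion = {v : S | ∀ u : S, ¬ (upperNonNilpotentGraph S).Adj v u}) ∧
    -- (2) transitivity and compatibility with the pseudo-nilpotent homomorphisms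
    (∀ i₁ i₂ i₃ : Fin P.length, P.cls i₁ ⊆ P.stem i₂ → P.cls i₂ ⊆ P.stem i₃ →
      P.cls i₁ ⊆ P.stem i₃ ∧
      ∀ (G₂ I₂ Λ₂ G₃ I₃ Λ₃ : Type*) [Group G₂] [Group G₃]
        (R₂ : ReesPresentation P i₂ G₂ I₂ Λ₂) (R₃ : ReesPresentation P i₃ G₃ I₃ Λ₃),
        ¬ P.FactorNilpotent i₂ → ¬ P.FactorNilpotent i₃ →
        ∀ a ∈ P.cls i₁, ∃ (q₂ : I₂ × Λ₂) (q₃ : I₃ × Λ₃), R₂.Phi a = q₂ ∧ R₃.Phi a = q₃ ∧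
          ∀ g : G₂, R₃.Phi (R₂.el g q₂) = q₃) ∧
    -- (3) a class that is neither isolated nor a root lies in the stem of a lower root
    (∀ i : Fin P.length, ¬ P.IsIsolatedClass i → ¬ P.IsRoot i →
      ∃ j : Fin P.length, P.IsRoot j ∧ i < j ∧ P.cls i ⊆ P.stem j) ∧
    -- (4) the complement of `K` is the union of the stems
    P.isolatedUnionᶜ = ⋃ (i : Fin P.length) (_ : P.IsRoot i), P.stem i ∧
    -- (5) stems are subsemigroups
    (∀ i : Fin P.length, P.IsRoot i → ∀ a ∈ P.stem i, ∀ b ∈ P.stem i, a * b ∈ P.stem i) ∧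
    -- (6) products of principal classes
    (∀ i j : Fin P.length, P.cls i * P.cls j ⊆ P.isolatedUnion ↔
      ¬ ∃ k : Fin P.length, P.IsRoot k ∧ P.cls i ⊆ P.stem k ∧ P.cls j ⊆ P.stem k) := by
  have hL := hS.hasLocalSurvivors
  refine ⟨⟨⟨P.isolatedIdeal hL, rfl, P.isMalcevNilpotent_isolatedIdeal hL,
    P.subset_isolatedUnion_of_isMalcevNilpotent hL⟩, P.isolatedUnion_eq_isolated_vertices hL⟩,
    ?_, ?_, ?_, ?_, ?_⟩
  · refine fun i₁ i₂ i₃ h₁₂ h₂₃ => ⟨P.cls_subset_stem_trans h₁₂ h₂₃, ?_⟩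
    intro G₂ I₂ Λ₂ G₃ I₃ Λ₃ _ _ R₂ R₃ h₂ h₃ a ha
    have h₁₃ := P.cls_subset_stem_trans h₁₂ h₂₃
    rw [P.stem_eq hL h₂] at h₁₂
    rw [P.stem_eq hL h₃] at h₁₃ h₂₃
    obtain ⟨q₂, hq₂⟩ := R₂.exists_phi_eq hL h₂ (h₁₂ ha)
    obtain ⟨q₃, hq₃⟩ := R₃.exists_phi_eq hL h₃ (h₁₃ ha)
    refine ⟨q₂, q₃, hq₂, hq₃, fun g => ?_⟩
    have hg := R₂.el_mem g q₂
    rw [R₃.phi_eq_iff hL h₃ (h₂₃ hg)]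
    refine SameAction.trans (SameAction.symm ?_) ((R₃.phi_eq_iff hL h₃ (h₁₃ ha) q₃).1 hq₃)
    -- `a` and `(g; q₂)` act equally on the class `i₂`, so they generate a nilpotent semigroup
    -- and must act equally on every other class
    by_contra hn
    have hs := (P.isSimpleBlock hL h₃).survives_of_not_sameAction hL (h₁₃ ha) (h₂₃ hg) hn
      (T := (Subsemigroup.closure ({a, R₂.el g q₂} : Set S) : Set S))
    exact (P.isSimpleBlock hL h₂).not_survives_closure_of_sameAction hL (h₁₂ ha) hg
      (((R₂.phi_eq_iff hL h₂ (h₁₂ ha) q₂).1 hq₂).trans ((R₂.sameAction_el_iff hL h₂).2 rfl))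
      (Subsemigroup.subset_closure (Or.inl rfl)) (Subsemigroup.subset_closure (Or.inr rfl))
      (hs.mono (Set.empty_subset _) subset_rfl)
  · intro i hi hr
    obtain ⟨s, hs⟩ := P.cls_nonempty i
    have hK : s ∉ P.isolatedUnion := by
      intro h
      obtain ⟨j, hj, hsj⟩ := Set.mem_iUnion₂.1 h
      exact hi (P.eq_of_mem_cls hs hsj ▸ hj)
    obtain ⟨r, hroot, hsr⟩ := (P.notMem_isolatedUnion_iff hL).1 hK
    have hsub := P.cls_subset_stem_of_mem hL hroot hs hsr
    refine ⟨r, hroot, lt_of_le_of_ne (P.cls_subset_stem_iff.1 hsub).1 ?_, hsub⟩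
    rintro rfl
    exact hr hroot
  · ext s
    rw [Set.mem_compl_iff, P.notMem_isolatedUnion_iff hL]
    simp only [Set.mem_iUnion, exists_prop]
  · exact fun i hi a ha b hb => (P.mul_mem_stem_iff hL hi).2 ⟨ha, hb⟩
  · intro i j
    constructor
    · rintro h ⟨k, hk, hik, hjk⟩
      obtain ⟨a, ha⟩ := P.cls_nonempty i
      obtain ⟨b, hb⟩ := P.cls_nonempty j
      exact (P.notMem_isolatedUnion_iff hL).2
        ⟨k, hk, (P.mul_mem_stem_iff hL hk).2 ⟨hik ha, hjk hb⟩⟩ (h (Set.mul_mem_mul ha hb))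
    · rintro h _ ⟨a, ha, b, hb, rfl⟩
      by_contra hn
      obtain ⟨r, hr, hab⟩ := (P.notMem_isolatedUnion_iff hL).1 hn
      obtain ⟨har, hbr⟩ := (P.mul_mem_stem_iff hL hr).1 hab
      exact h ⟨r, hr, P.cls_subset_stem_of_mem hL hr ha har,
        P.cls_subset_stem_of_mem hL hr hb hbr⟩
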